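/- Let $T$ be an ergodic automorphism of a standard Borel probability space $(X,\mathcal B,\mu)$, let $S$ be an automorphism of $(X,\mathcal B,\mu)$ with $ST=TS$ ($\mu$-a.e.), and let $\varphi:X\to\mathbb Z_2=\{0,1\}$ be measurable. Let $\lambda$ be the normalized Haar measure of $\mathbb Z_2^{\mathbb Z}$, put $\psi(x)=(\varphi(S^sx))_{s\in\mathbb Z}\in\mathbb Z_2^{\mathbb Z}$, and define on $(X\times\mathbb Z_2^{\mathbb Z},\mu\otimes\lambda)$ $$T_1(x,i)=\bigl(Tx,\,(i_s+\varphi(S^sx))_{s\in\mathbb Z}\bigr),\qquad T_2(x,i)=\bigl(Tx,\,(i_s+\varphi(S^{\kappa(s)}x))_{s\in\mathbb Z}\bigr),$$ $$I_n(x,i)=\bigl(S^nx,\,(i_{n+\kappa(s)})_{s\in\mathbb Z}\bigr)\quad(n\in\mathbb Z),\qquad \kappa(s)=s\text{ for }s\le 0,\quad \kappa(s)=s+1\text{ for }s\ge 1 .$$ Assume that the group extension $T_\varphi(x,g)=(Tx,\varphi(x)+g)$ of $T$ to $X\times\mathbb Z_2$ and the group extension $T_1=T_\psi$ are ergodic.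 For a measure-preserving map $R$ write $U_RF=F\circ R$ on complex $L^2$. A Markov operator between $L^2$-spaces of probability spaces is a linear contraction $\Phi$ which preserves the cone of non-negative functions and satisfies $\Phi 1=1=\Phi^*1$. Operators $A_1$ on $H_1=L^2(\mu_1)$ and $A_2$ on $H_2=L^2(\mu_2)$ are Markov quasi-similar if there are Markov operators $V:H_1\to H_2$ and $W:H_2\to H_1$ with dense ranges, $VA_1=A_2V$ and $WA_2=A_1W$; $A_1$ and $A_2$ are Markov quasi-affine if there is an injective Markov operator $V:H_1\to H_2$ with dense range and $VA_1=A_2V$. Let $\mathcal A$ be the set of non-negative $a=(a_n)_{n\in\mathbb Z}\in\ell^2(\mathbb Z)$ with $\sum_n a_n=1$ such that, for every complex $x\in\ell^2(\mathbb Z)$, if $a*x$ has finite support then $x=0$. For $a\in\mathcal A$ put $J_a=\sum_{n\in\mathbb Z}a_nU_{I_n}$ on $L^2(X\times\mathbb Z_2^{\mathbb Z},\mu\otimes\lambda)$. The maps $T_1,T_2,I_n$ preserve $\mu\otimes\lambda$. Then: 1. $I_n\circ T_1=T_2\circ I_n$ a.e., for every $n\in\mathbb Z$. 2. For every $a\in\mathcal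 A$, $J_a$ is a Markov operator, $U_{T_1}J_a=J_aU_{T_2}$ and $U_{T_2}J_a^*=J_a^*U_{T_1}$. If moreover $\sum_n a_nU_{S^n}$ is injective on $L^2(X,\mu)$, then $J_a$ and $J_a^*$ are injective and have dense ranges. 3. There is $a\in\mathcal A$ for which $J_a$ and $J_a^*$ are injective and have dense ranges. 4. Consequently $U_{T_1}$ and $U_{T_2}$ are Markov quasi-affine (in both directions), and in particular $T_1$ and $T_2$ are Markov quasi-similar. -/

import Mathlib

open MeasureTheory ProbabilityTheory Filter
open scoped ENNReal ComplexOrder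

noncomputable section

namespace MarkovQS

/-! ### Koopman operators and Markov operators -/

section Operators

variable {Ω₁ Ω₂ : Type*} [MeasurableSpace Ω₁] [MeasurableSpace Ω₂]

/-- The Koopman operator `F ↦ F ∘ f` of a measure-preserving map `f : Ω₁ → Ω₂`, on complex `L²`. -/
def koopman {μ₁ : Measure Ω₁} {μ₂ : Measure Ω₂} (f : Ω₁ → Ω₂) (hf : MeasurePreserving f μ₁ μ₂) :
    Lp ℂ 2 μ₂ →L[ℂ] Lp ℂ 2 μ₁ :=
  (Lp.compMeasurePreservingₗᵢ ℂ f hf).toContinuousLinearMap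

/-- Markov operators: linear contractions of `L²` spaces which preserve the cone of non-negative
functions and satisfy `Φ 1 = 1 = Φ* 1`. (In the complex order, `0 ≤ z` means that `z` is real and
non-negative.) -/
structure IsMarkov {μ₁ : Measure Ω₁} {μ₂ : Measure Ω₂} [IsProbabilityMeasure μ₁]
    [IsProbabilityMeasure μ₂] (Φ : Lp ℂ 2 μ₁ →L[ℂ] Lp ℂ 2 μ₂) : Prop where
  contraction : ‖Φ‖ ≤ 1
  positive : ∀ f : Lp ℂ 2 μ₁, (∀ᵐ x ∂μ₁, 0 ≤ f x) → ∀ᵐ y ∂μ₂, 0 ≤ Φ f y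
  map_one : Φ (Lp.const 2 μ₁ (1 : ℂ)) = Lp.const 2 μ₂ (1 : ℂ)
  adjoint_map_one :
    ContinuousLinearMap.adjoint Φ (Lp.const 2 μ₂ (1 : ℂ)) = Lp.const 2 μ₁ (1 : ℂ)

/-- `A₂` is a Markov quasi-image of `A₁`: some Markov operator with dense range intertwines `A₁`
and `A₂`. -/
def IsMarkovQuasiImage {μ₁ : Measure Ω₁} {μ₂ : Measure Ω₂} [IsProbabilityMeasure μ₁]
    [IsProbabilityMeasure μ₂] (A₂ : Lp ℂ 2 μ₂ →L[ℂ] Lp ℂ 2 μ₂) (A₁ : Lp ℂ 2 μ₁ →L[ℂ] Lp ℂ 2 μ₁) :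
    Prop :=
  ∃ V : Lp ℂ 2 μ₁ →L[ℂ] Lp ℂ 2 μ₂, IsMarkov V ∧ DenseRange V ∧ V ∘L A₁ = A₂ ∘L V

/-- Markov quasi-similarity: each operator is a Markov quasi-image of the other one. -/
def MarkovQuasiSimilar {μ₁ : Measure Ω₁} {μ₂ : Measure Ω₂} [IsProbabilityMeasure μ₁]
    [IsProbabilityMeasure μ₂] (A₁ : Lp ℂ 2 μ₁ →L[ℂ] Lp ℂ 2 μ₁) (A₂ : Lp ℂ 2 μ₂ →L[ℂ] Lp ℂ 2 μ₂) :
    Prop :=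
  IsMarkovQuasiImage A₂ A₁ ∧ IsMarkovQuasiImage A₁ A₂

/-- Markov quasi-affinity: some injective Markov operator with dense range intertwines `A₁` and
`A₂`. -/
def MarkovQuasiAffine {μ₁ : Measure Ω₁} {μ₂ : Measure Ω₂} [IsProbabilityMeasure μ₁]
    [IsProbabilityMeasure μ₂] (A₁ : Lp ℂ 2 μ₁ →L[ℂ] Lp ℂ 2 μ₁) (A₂ : Lp ℂ 2 μ₂ →L[ℂ] Lp ℂ 2 μ₂) :
    Prop :=
  ∃ V : Lp ℂ 2 μ₁ →L[ℂ] Lp ℂ 2 μ₂,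
    IsMarkov V ∧ Function.Injective V ∧ DenseRange V ∧ V ∘L A₁ = A₂ ∘L V

end Operators

/-! ### The weights -/

/-- Convolution of sequences indexed by `ℤ`. -/
def conv (a : ℤ → ℝ) (x : ℤ → ℂ) (n : ℤ) : ℂ := ∑' k : ℤ, (a k : ℂ) * x (n - k)

/-- Non-negative sequences `a ∈ ℓ²(ℤ)` of sum `1` such that, for `x ∈ ℓ²(ℤ)`, the convolution
`a * x` is finitely supported only if `x = 0`. -/
structure IsAdmissible (a : ℤ → ℝ) : Prop where
  nonneg : ∀ n, 0 ≤ a n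
  memℓp : Memℓp a 2
  hasSum : HasSum a 1
  eq_zero_of_conv : ∀ x : ℤ → ℂ, Memℓp x 2 → (Function.support (conv a x)).Finite → x = 0

/-! ### Haar measure on `ℤ₂` and on `ℤ₂^ℤ` -/

/-- The normalized Haar measure of `ℤ₂`. -/
def coin : Measure (ZMod 2) := uniformOn Set.univ

instance : IsProbabilityMeasure coin := by unfold coin; infer_instance

/-- The normalized Haar measure of `ℤ₂^ℤ`, i.e. the product of the measures `coin`. -/
def cubeHaar : Measure (ℤ → ZMod 2) := Measure.infinitePi fun _ => coin

instance : IsProbabilityMeasure cubeHaar := by unfold cubeHaar; infer_instance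

theorem coin_map_add (g : ZMod 2) : coin.map (fun x => g + x) = coin := by
  ext s _
  rw [Measure.map_apply (by fun_prop) (MeasurableSet.of_discrete), coin, uniformOn_univ,
    uniformOn_univ]
  congr 1
  have h : (fun x => g + x) ⁻¹' s = (Equiv.addLeft g).symm '' s :=
    ((Equiv.addLeft g).image_symm_eq_preimage s).symm
  rw [h, Measure.count_injective_image (Equiv.addLeft g).symm.injective]

theorem cubeHaar_map_add (g : ℤ → ZMod 2) : cubeHaar.map (fun x => g + x) = cubeHaar := by
  have h := Measure.infinitePi_map_pi (fun _ : ℤ => coin) (f := fun s x => g s + x)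
    (fun s => by fun_prop)
  simp only [coin_map_add] at h
  exact h

/-! ### The automorphisms and the maps between them -/

variable {X : Type*} [MeasurableSpace X] {μ : Measure X}

/-- The group extension `T_φ (x, g) = (T x, φ x + g)`. -/
def groupExtension {G : Type*} [Add G] (T : X → X) (φ : X → G) (p : X × G) : X × G :=
  (T p.1, φ p.1 + p.2)

/-- The power `S ^ n`, for `n : ℤ`, of an invertible map. -/
def ipow (S : X ≃ᵐ X) (n : ℤ) : X → X := ⇑((S.toEquiv : Equiv.Perm X) ^ n)

/-- The cocycle `ψ x = (φ (S ^ s x))_{s ∈ ℤ}`. -/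
def psi (S : X ≃ᵐ X) (φ : X → ZMod 2) (x : X) : ℤ → ZMod 2 := fun s => φ (ipow S s x)

/-- The increasing enumeration of `ℤ ∖ {1}` which fixes all `s ≤ 0`. -/
def skipOne (s : ℤ) : ℤ := if s ≤ 0 then s else s + 1

/-- `T₁ = T_ψ`. -/
def T₁ (T S : X ≃ᵐ X) (φ : X → ZMod 2) : X × (ℤ → ZMod 2) → X × (ℤ → ZMod 2) :=
  groupExtension T (psi S φ)

/-- `T₂` is obtained from `T₁` by forgetting the coordinate with index `1`. -/
def T₂ (T S : X ≃ᵐ X) (φ : X → ZMod 2) : X × (ℤ → ZMod 2) → X × (ℤ → ZMod 2) :=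
  groupExtension T fun x s => psi S φ x (skipOne s)

/-- `I_n (x, i) = (S ^ n x, (…, i_{n-1}, i_n, i_{n+2}, i_{n+3}, …))`, where `i_n` is the entry with
index `0`. -/
def imap (S : X ≃ᵐ X) (n : ℤ) (p : X × (ℤ → ZMod 2)) : X × (ℤ → ZMod 2) :=
  (ipow S n p.1, fun s => p.2 (n + skipOne s))

theorem ipow_measurePreserving {S : X ≃ᵐ X} (hS : MeasurePreserving S μ μ) (n : ℤ) :
    MeasurePreserving (ipow S n) μ μ := by
  have hnat : ∀ k : ℕ, MeasurePreserving (ipow S k) μ μ := fun k => by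
    have h : ipow S k = (⇑S)^[k] := by
      unfold ipow
      rw [zpow_natCast, ← Equiv.Perm.iterate_eq_pow]
      rfl
    rw [h]
    exact hS.iterate k
  have hneg : ∀ k : ℕ, MeasurePreserving (ipow S (-(k : ℤ))) μ μ := fun k => by
    have h : ipow S (-(k : ℤ)) = (⇑S.symm)^[k] := by
      unfold ipow
      rw [← inv_zpow', zpow_natCast, ← Equiv.Perm.iterate_eq_pow]
      rfl
    rw [h]
    exact (hS.symm S).iterate k
  obtain ⟨k, rfl | rfl⟩ := n.eq_nat_or_neg
  · exact hnat k
  · exact hneg k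

theorem psi_measurable {S : X ≃ᵐ X} (hS : MeasurePreserving S μ μ) {φ : X → ZMod 2}
    (hφ : Measurable φ) : Measurable (psi S φ) :=
  measurable_pi_lambda _ fun s => hφ.comp (ipow_measurePreserving hS s).measurable

variable [IsProbabilityMeasure μ]

theorem groupExtension_measurePreserving {T : X ≃ᵐ X} (hT : MeasurePreserving T μ μ)
    {ψ : X → ℤ → ZMod 2} (hψ : Measurable ψ) :
    MeasurePreserving (groupExtension T ψ) (μ.prod cubeHaar) (μ.prod cubeHaar) :=
  hT.skew_product (g := fun x i => ψ x + i) (by unfold Function.uncurry; fun_prop)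
    (Eventually.of_forall fun x => cubeHaar_map_add (ψ x))

theorem T₁_measurePreserving {T S : X ≃ᵐ X} (hT : MeasurePreserving T μ μ)
    (hS : MeasurePreserving S μ μ) {φ : X → ZMod 2} (hφ : Measurable φ) :
    MeasurePreserving (T₁ T S φ) (μ.prod cubeHaar) (μ.prod cubeHaar) :=
  groupExtension_measurePreserving hT (psi_measurable hS hφ)

theorem T₂_measurePreserving {T S : X ≃ᵐ X} (hT : MeasurePreserving T μ μ)
    (hS : MeasurePreserving S μ μ) {φ : X → ZMod 2} (hφ : Measurable φ) :
    MeasurePreserving (T₂ T S φ) (μ.prod cubeHaar) (μ.prod cubeHaar) :=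
  groupExtension_measurePreserving hT
    (measurable_pi_lambda _ fun s => (measurable_pi_apply (skipOne s)).comp (psi_measurable hS hφ))

theorem skipOne_injective : Function.Injective skipOne := fun s t h => by
  unfold skipOne at h
  split_ifs at h <;> omega

theorem imap_measurePreserving {S : X ≃ᵐ X} (hS : MeasurePreserving S μ μ) (n : ℤ) :
    MeasurePreserving (imap S n) (μ.prod cubeHaar) (μ.prod cubeHaar) := by
  have h : MeasurePreserving (fun (i : ℤ → ZMod 2) s => i (n + skipOne s)) cubeHaar cubeHaar :=
    ⟨by fun_prop, Measure.map_infinitePi_infinitePi_of_inj (P := fun _ : ℤ => coin)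
      (f := fun s => n + skipOne s) ((add_right_injective n).comp skipOne_injective)⟩
  exact (ipow_measurePreserving hS n).prod h

/-! ### The operators -/

theorem summable_smul_of_norm_le_one {E : Type*} [NormedAddCommGroup E] [NormedSpace ℂ E]
    [CompleteSpace E] {a : ℤ → ℝ} (ha : IsAdmissible a) {V : ℤ → E} (hV : ∀ n, ‖V n‖ ≤ 1) :
    Summable fun n => (a n : ℂ) • V n := by
  refine ha.hasSum.summable.of_norm_bounded fun n => ?_
  rw [norm_smul, Complex.norm_real, Real.norm_of_nonneg (ha.nonneg n)]
  exact mul_le_of_le_one_right (ha.nonneg n) (hV n)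

theorem norm_koopman_le {Ω₁ Ω₂ : Type*} [MeasurableSpace Ω₁] [MeasurableSpace Ω₂]
    {μ₁ : Measure Ω₁} {μ₂ : Measure Ω₂} {f : Ω₁ → Ω₂} (hf : MeasurePreserving f μ₁ μ₂) :
    ‖koopman f hf‖ ≤ 1 :=
  LinearIsometry.norm_toContinuousLinearMap_le _

/-- `J = ∑ₙ a_n U_{I_n}` (convergent in operator norm if `a` is admissible, see
`summable_smul_of_norm_le_one` and `norm_koopman_le`). -/
def opJ (a : ℤ → ℝ) (S : X ≃ᵐ X) (hS : MeasurePreserving S μ μ) :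
    Lp ℂ 2 (μ.prod cubeHaar) →L[ℂ] Lp ℂ 2 (μ.prod cubeHaar) :=
  ∑' n : ℤ, (a n : ℂ) • koopman (imap S n) (imap_measurePreserving hS n)

/-- `∑ₙ a_n U_{S^n}` on `L²(X, μ)`. -/
def opBase (a : ℤ → ℝ) (S : X ≃ᵐ X) (hS : MeasurePreserving S μ μ) : Lp ℂ 2 μ →L[ℂ] Lp ℂ 2 μ :=
  ∑' n : ℤ, (a n : ℂ) • koopman (ipow S n) (ipow_measurePreserving hS n)

end MarkovQS

end

noncomputable section

namespace MarkovQS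

section Koopman

variable {Ω Ω₁ Ω₂ Ω₃ : Type*} [MeasurableSpace Ω] [MeasurableSpace Ω₁] [MeasurableSpace Ω₂]
  [MeasurableSpace Ω₃] {ν : Measure Ω} {μ₁ : Measure Ω₁} {μ₂ : Measure Ω₂} {μ₃ : Measure Ω₃}

theorem coeFn_koopman {f : Ω₁ → Ω₂} (hf : MeasurePreserving f μ₁ μ₂) (F : Lp ℂ 2 μ₂) :
    koopman f hf F =ᵐ[μ₁] F ∘ f :=
  Lp.coeFn_compMeasurePreserving F hf

theorem koopman_congr {f g : Ω₁ → Ω₂} (hf : MeasurePreserving f μ₁ μ₂)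
    (hg : MeasurePreserving g μ₁ μ₂) (h : f =ᵐ[μ₁] g) : koopman f hf = koopman g hg := by
  ext1 F
  refine Lp.ext ?_
  filter_upwards [coeFn_koopman hf F, coeFn_koopman hg F, h] with x h1 h2 h3
  rw [h1, h2, Function.comp_apply, Function.comp_apply, h3]

theorem koopman_comp {f : Ω₁ → Ω₂} {g : Ω₂ → Ω₃} (hf : MeasurePreserving f μ₁ μ₂)
    (hg : MeasurePreserving g μ₂ μ₃) :
    koopman f hf ∘L koopman g hg = koopman (g ∘ f) (hg.comp hf) := by
  ext1 F
  exact (Lp.compMeasurePreserving_comp_apply F hg hf).symm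

theorem inner_koopman_koopman {f : Ω₁ → Ω₂} (hf : MeasurePreserving f μ₁ μ₂) (F G : Lp ℂ 2 μ₂) :
    inner ℂ (koopman f hf F) (koopman f hf G) = inner ℂ F G :=
  LinearIsometry.inner_map_map _ F G

theorem koopman_injective {f : Ω₁ → Ω₂} (hf : MeasurePreserving f μ₁ μ₂) :
    Function.Injective (koopman f hf) :=
  (Lp.isometry_compMeasurePreserving (p := 2) hf).injective

theorem koopman_id (h : MeasurePreserving (id : Ω → Ω) ν ν) :
    koopman id h = ContinuousLinearMap.id ℂ (Lp ℂ 2 ν) := by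
  ext1 F
  exact Lp.compMeasurePreserving_id_apply F

variable [IsProbabilityMeasure μ₁] [IsProbabilityMeasure μ₂]

theorem koopman_const {f : Ω₁ → Ω₂} (hf : MeasurePreserving f μ₁ μ₂) (c : ℂ) :
    koopman f hf (Lp.const 2 μ₂ c) = Lp.const 2 μ₁ c := by
  refine Lp.ext ?_
  filter_upwards [coeFn_koopman hf (Lp.const 2 μ₂ c), Lp.coeFn_const (p := 2) (μ := μ₁) c,
    hf.quasiMeasurePreserving.ae (Lp.coeFn_const (p := 2) (μ := μ₂) c)] with x h1 h2 h3
  rw [h1, h2, Function.comp_apply, h3]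
  rfl

theorem inner_nonneg_of_ae {g h : Lp ℂ 2 ν} (hg : ∀ᵐ x ∂ν, 0 ≤ g x) (hh : ∀ᵐ x ∂ν, 0 ≤ h x) :
    0 ≤ inner ℂ g h := by
  rw [L2.inner_def]
  refine integral_nonneg_of_ae ?_
  filter_upwards [hg, hh] with x h1 h2
  rw [RCLike.inner_apply]
  exact mul_nonneg h2 (star_nonneg_iff.2 h1)

variable [IsProbabilityMeasure ν]

/-- The indicator function of a measurable set. -/
abbrev ind (ν : Measure Ω) [IsProbabilityMeasure ν] {s : Set Ω} (hs : MeasurableSet s) :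
    Lp ℂ 2 ν :=
  indicatorConstLp 2 hs (measure_ne_top ν s) (1 : ℂ)

theorem ind_nonneg {s : Set Ω} (hs : MeasurableSet s) : ∀ᵐ x ∂ν, 0 ≤ ind ν hs x := by
  filter_upwards [indicatorConstLp_coeFn (p := 2) (hs := hs) (hμs := measure_ne_top ν s)
    (c := (1 : ℂ))] with x hx
  rw [hx]
  exact Set.indicator_nonneg (fun _ _ => zero_le_one) x

theorem ae_nonneg_of_inner_ind {h : Lp ℂ 2 ν}
    (H : ∀ (s : Set Ω) (hs : MeasurableSet s), 0 ≤ inner ℂ (ind ν hs) h) :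
    ∀ᵐ x ∂ν, 0 ≤ h x := by
  have hi : Integrable h ν := (Lp.memLp h).integrable (by norm_num)
  have hre := ae_nonneg_of_forall_setIntegral_nonneg (f := fun x => RCLike.re (h x)) hi.re
    fun s hs _ => by
      have := (Complex.nonneg_iff.1 (H s hs)).1
      rw [L2.inner_indicatorConstLp_one] at this
      rwa [integral_re hi.integrableOn]
  have him := Integrable.ae_eq_zero_of_forall_setIntegral_eq_zero
    (f := fun x => RCLike.im (h x)) hi.im fun s hs _ => by
      have := (Complex.nonneg_iff.1 (H s hs)).2
      rw [L2.inner_indicatorConstLp_one] at this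
      rw [integral_im hi.integrableOn]
      exact this.symm
  filter_upwards [hre, him] with x h1 h2
  exact Complex.nonneg_iff.2 ⟨h1, h2.symm⟩

theorem IsMarkov.adjoint {Φ : Lp ℂ 2 μ₁ →L[ℂ] Lp ℂ 2 μ₂} (hΦ : IsMarkov Φ) :
    IsMarkov (ContinuousLinearMap.adjoint Φ) where
  contraction := by
    rw [LinearIsometryEquiv.norm_map]
    exact hΦ.contraction
  positive f hf := by
    refine ae_nonneg_of_inner_ind fun s hs => ?_
    rw [ContinuousLinearMap.adjoint_inner_right]
    exact inner_nonneg_of_ae (hΦ.positive _ (ind_nonneg hs)) hf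
  map_one := hΦ.adjoint_map_one
  adjoint_map_one := by
    rw [ContinuousLinearMap.adjoint_adjoint]
    exact hΦ.map_one

end Koopman

section Average

variable {H : Type*} [NormedAddCommGroup H] [InnerProductSpace ℂ H] [CompleteSpace H]

/-- The average `∑ₙ a_n V_n` of the operators `V_n`. -/
def average (a : ℤ → ℝ) (V : ℤ → H →L[ℂ] H) : H →L[ℂ] H := ∑' n : ℤ, (a n : ℂ) • V n

/-- Non-negative weights of sum `1`. -/
structure IsWeight (a : ℤ → ℝ) : Prop where
  nonneg : ∀ n, 0 ≤ a n
  hasSum : HasSum a 1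

theorem IsAdmissible.isWeight {a : ℤ → ℝ} (ha : IsAdmissible a) : IsWeight a :=
  ⟨ha.nonneg, ha.hasSum⟩

variable {a : ℤ → ℝ} {V : ℤ → H →L[ℂ] H}

theorem hasSum_average (ha : IsWeight a) (hV : ∀ n, ‖V n‖ ≤ 1) :
    HasSum (fun n => (a n : ℂ) • V n) (average a V) := by
  refine Summable.hasSum (ha.hasSum.summable.of_norm_bounded fun n => ?_)
  rw [norm_smul, Complex.norm_real, Real.norm_of_nonneg (ha.nonneg n)]
  exact mul_le_of_le_one_right (ha.nonneg n) (hV n)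

theorem hasSum_average_apply (ha : IsWeight a) (hV : ∀ n, ‖V n‖ ≤ 1) (f : H) :
    HasSum (fun n => (a n : ℂ) • V n f) (average a V f) :=
  (hasSum_average ha hV).mapL (ContinuousLinearMap.apply ℂ H f)

theorem hasSum_inner_average (ha : IsWeight a) (hV : ∀ n, ‖V n‖ ≤ 1) (f g : H) :
    HasSum (fun n => (a n : ℂ) * inner ℂ g (V n f)) (inner ℂ g (average a V f)) := by
  have := (hasSum_average_apply ha hV f).mapL (innerSL ℂ g)
  simpa only [map_smul, innerSL_apply_apply, smul_eq_mul] using this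

theorem norm_average_le (ha : IsWeight a) (hV : ∀ n, ‖V n‖ ≤ 1) : ‖average a V‖ ≤ 1 := by
  refine tsum_of_norm_bounded ha.hasSum fun n => ?_
  rw [norm_smul, Complex.norm_real, Real.norm_of_nonneg (ha.nonneg n)]
  exact mul_le_of_le_one_right (ha.nonneg n) (hV n)

theorem average_comp (ha : IsWeight a) (hV : ∀ n, ‖V n‖ ≤ 1) (B : H →L[ℂ] H)
    (hB : ‖B‖ ≤ 1) : average a V ∘L B = average a (fun n => V n ∘L B) := by
  ext1 f
  refine (hasSum_average_apply ha hV (B f)).unique (hasSum_average_apply ha (fun n => ?_) f)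
  exact ((V n).opNorm_comp_le B).trans (mul_le_one₀ (hV n) (norm_nonneg _) hB)

theorem comp_average (ha : IsWeight a) (hV : ∀ n, ‖V n‖ ≤ 1) (B : H →L[ℂ] H)
    (hB : ‖B‖ ≤ 1) : B ∘L average a V = average a (fun n => B ∘L V n) := by
  ext1 f
  have h := (hasSum_average_apply ha hV f).mapL B
  simp only [map_smul] at h
  refine h.unique (hasSum_average_apply ha (fun n => ?_) f)
  exact (B.opNorm_comp_le (V n)).trans (mul_le_one₀ hB (norm_nonneg _) (hV n))

end Average

section MarkovAverage

variable {Ω : Type*} [MeasurableSpace Ω] {ν : Measure Ω} [IsProbabilityMeasure ν]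

theorem isMarkov_average {a : ℤ → ℝ} (ha : IsWeight a) {f : ℤ → Ω → Ω}
    (hf : ∀ n, MeasurePreserving (f n) ν ν) :
    IsMarkov (average a fun n => koopman (f n) (hf n)) := by
  have hV : ∀ n, ‖koopman (f n) (hf n)‖ ≤ 1 := fun n => norm_koopman_le (hf n)
  have hc : HasSum (fun n => (a n : ℂ)) 1 := by
    rw [← Complex.ofReal_one]
    exact Complex.hasSum_ofReal.2 ha.hasSum
  refine ⟨norm_average_le ha hV, fun F hF => ae_nonneg_of_inner_ind fun s hs => ?_, ?_, ?_⟩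
  · refine (hasSum_inner_average ha hV F (ind ν hs)).nonneg fun n => ?_
    refine mul_nonneg (by exact_mod_cast ha.nonneg n) (inner_nonneg_of_ae (ind_nonneg hs) ?_)
    filter_upwards [coeFn_koopman (hf n) F, (hf n).quasiMeasurePreserving.ae hF] with x h1 h2
    rwa [h1]
  · refine (hasSum_average_apply ha hV _).unique ?_
    simp only [koopman_const]
    simpa using hc.smul_const (Lp.const 2 ν (1 : ℂ))
  · refine ext_inner_right ℂ fun F => ?_
    rw [ContinuousLinearMap.adjoint_inner_left]
    refine (hasSum_inner_average ha hV F _).unique ?_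
    have : ∀ n, inner ℂ (Lp.const 2 ν (1 : ℂ)) (koopman (f n) (hf n) F) =
        inner ℂ (Lp.const 2 ν (1 : ℂ)) F := fun n => by
      conv_lhs => rw [← koopman_const (hf n) 1]
      exact inner_koopman_koopman _ _ _
    simp only [this]
    simpa using hc.mul_right (inner ℂ (Lp.const 2 ν (1 : ℂ)) F)

end MarkovAverage

section UnitaryRep

variable {H : Type*} [NormedAddCommGroup H] [InnerProductSpace ℂ H]

/-- Unitary representations of `ℤ`. -/
structure IsUnitaryRep (W : ℤ → H →L[ℂ] H) : Prop where
  map_zero : W 0 = ContinuousLinearMap.id ℂ H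
  map_add : ∀ m n, W (m + n) = W m ∘L W n
  inner_map_map : ∀ n f g, inner ℂ (W n f) (W n g) = inner ℂ f g

namespace IsUnitaryRep

variable {W : ℤ → H →L[ℂ] H} (hW : IsUnitaryRep W)
include hW

theorem map_add_apply (m n : ℤ) (f : H) : W (m + n) f = W m (W n f) := by
  rw [hW.map_add]
  rfl

theorem inner_map_left (n : ℤ) (f g : H) : inner ℂ (W n f) g = inner ℂ f (W (-n) g) := by
  rw [← hW.inner_map_map (-n), ← hW.map_add_apply, neg_add_cancel, hW.map_zero]
  rfl

theorem norm_le (n : ℤ) : ‖W n‖ ≤ 1 := by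
  refine ContinuousLinearMap.opNorm_le_bound _ zero_le_one fun f => ?_
  rw [one_mul, @norm_eq_sqrt_re_inner ℂ, hW.inner_map_map, ← norm_eq_sqrt_re_inner]

theorem norm_map (n : ℤ) (f : H) : ‖W n f‖ = ‖f‖ := by
  rw [@norm_eq_sqrt_re_inner ℂ, hW.inner_map_map, ← norm_eq_sqrt_re_inner]

theorem memℓp_inner {e : H} (he : ∀ n, n ≠ 0 → inner ℂ (W n e) e = 0) (F : H) :
    Memℓp (fun n => inner ℂ (W n e) F) 2 := by
  rcases eq_or_ne e 0 with rfl | hne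
  · convert zero_memℓp (p := 2) (E := fun _ : ℤ => ℂ) using 1
    ext n
    simp
  have hn : ‖e‖ ≠ 0 := norm_ne_zero_iff.2 hne
  have horth : Orthonormal ℂ fun n => ((‖e‖⁻¹ : ℝ) : ℂ) • W n e := by
    refine ⟨fun n => ?_, fun m n hmn => ?_⟩
    · rw [norm_smul, hW.norm_map, Complex.norm_real, norm_inv, norm_norm, inv_mul_cancel₀ hn]
    · change inner ℂ (((‖e‖⁻¹ : ℝ) : ℂ) • W m e) (((‖e‖⁻¹ : ℝ) : ℂ) • W n e) = 0
      rw [inner_smul_left, inner_smul_right, ← neg_neg n, ← hW.inner_map_left,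
        ← hW.map_add_apply, he _ (by omega), mul_zero, mul_zero]
  refine (memℓp_gen_iff (by norm_num)).2 ?_
  have := (horth.inner_products_summable F).mul_left (‖e‖ ^ 2)
  refine this.congr fun n => ?_
  rw [inner_smul_left, norm_mul, mul_pow, Complex.conj_ofReal, Complex.norm_real, norm_inv,
    norm_norm, ← mul_assoc, ← mul_pow, mul_inv_cancel₀ hn]
  norm_num

variable [CompleteSpace H]

variable {a : ℤ → ℝ} (ha : IsWeight a)
include ha

theorem adjoint_average :
    ContinuousLinearMap.adjoint (average a W) = average a fun n => W (-n) := by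
  symm
  rw [ContinuousLinearMap.eq_adjoint_iff]
  intro f g
  have h1 := hasSum_inner_average ha (V := fun n => W (-n)) (fun n => hW.norm_le _) f g
  have h2 := hasSum_inner_average ha hW.norm_le g f
  have h3 := h1.star
  rw [← inner_conj_symm]
  refine h3.unique ?_
  convert h2 using 2 with n
  rw [star_mul', ← hW.inner_map_left]
  simp

theorem average_comp_adjoint :
    average a W ∘L ContinuousLinearMap.adjoint (average a W) =
      ContinuousLinearMap.adjoint (average a W) ∘L average a W := by
  have hA := norm_average_le ha hW.norm_le
  have hW' : ∀ n, ‖W (-n)‖ ≤ 1 := fun n => hW.norm_le _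
  rw [hW.adjoint_average ha, comp_average ha hW' _ hA, average_comp ha hW' _ hA]
  congr 1
  ext1 n
  rw [comp_average ha hW.norm_le _ (hW' n), average_comp ha hW.norm_le _ (hW' n)]
  congr 1
  ext1 m
  rw [← hW.map_add, ← hW.map_add, add_comm]

theorem adjoint_average_apply_eq_zero_iff (f : H) :
    ContinuousLinearMap.adjoint (average a W) f = 0 ↔ average a W f = 0 := by
  have h : average a W (ContinuousLinearMap.adjoint (average a W) f) =
      ContinuousLinearMap.adjoint (average a W) (average a W f) :=
    congr($(hW.average_comp_adjoint ha) f)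
  constructor
  · intro hf
    rw [hf, _root_.map_zero] at h
    rw [← inner_self_eq_zero (𝕜 := ℂ), ← ContinuousLinearMap.adjoint_inner_left, ← h,
      inner_zero_left]
  · intro hf
    rw [hf, _root_.map_zero] at h
    rw [← inner_self_eq_zero (𝕜 := ℂ), ContinuousLinearMap.adjoint_inner_right, h,
      inner_zero_left]

theorem injective_adjoint_average (h : Function.Injective (average a W)) :
    Function.Injective (ContinuousLinearMap.adjoint (average a W)) := by
  rw [injective_iff_map_eq_zero] at h ⊢
  exact fun f hf => h f ((hW.adjoint_average_apply_eq_zero_iff ha f).1 hf)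

omit ha

theorem inner_eq_zero_of_average_eq_zero {a : ℤ → ℝ} (ha : IsAdmissible a) {e F : H}
    (he : ∀ n, n ≠ 0 → inner ℂ (W n e) e = 0) (hF : average a W F = 0) : inner ℂ e F = 0 := by
  have hconv : conv a (fun n => inner ℂ (W n e) F) = 0 := by
    ext m
    refine HasSum.tsum_eq ?_
    have h := hasSum_inner_average ha.isWeight hW.norm_le F (W m e)
    rw [hF, inner_zero_right] at h
    refine h.congr_fun fun n => ?_
    beta_reduce
    rw [show m - n = -n + m by ring, hW.map_add_apply, hW.inner_map_left, neg_neg]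
  have h := congrFun (ha.eq_zero_of_conv _ (hW.memℓp_inner he F) (by rw [hconv]; simp)) 0
  simpa [hW.map_zero] using h

theorem inner_eq_zero_of_inner_average {a : ℤ → ℝ} (ha : IsAdmissible a) {e F : H}
    (he : ∀ n, n ≠ 0 → inner ℂ (W n e) e = 0)
    (hF : {m : ℤ | inner ℂ (average a W (W m e)) F ≠ 0}.Finite) : inner ℂ e F = 0 := by
  have hW' : IsUnitaryRep fun n => W (-n) :=
    ⟨by simpa using hW.map_zero, fun m n => by rw [neg_add, hW.map_add],
      fun n => hW.inner_map_map (-n)⟩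
  have he' : ∀ n, n ≠ 0 → inner ℂ (W (-n) e) e = 0 := fun n hn => he _ (neg_ne_zero.2 hn)
  have hconv : ∀ m, conv a (fun n => inner ℂ (W (-n) e) F) m =
      inner ℂ (average a W (W (-m) e)) F := by
    intro m
    refine HasSum.tsum_eq ?_
    have h := hasSum_inner_average ha.isWeight hW'.norm_le F (W (-m) e)
    rw [← hW.adjoint_average ha.isWeight, ContinuousLinearMap.adjoint_inner_right] at h
    refine h.congr_fun fun n => ?_
    beta_reduce
    rw [show -(m - n) = n + -m by ring, hW.map_add_apply, hW.inner_map_left]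
  have hfin : (Function.support (conv a (fun n => inner ℂ (W (-n) e) F))).Finite := by
    refine (hF.image Neg.neg).subset fun m hm => ⟨-m, ?_, neg_neg m⟩
    rw [Function.mem_support, hconv] at hm
    exact hm
  have h := congrFun (ha.eq_zero_of_conv _ (hW'.memℓp_inner he' F) hfin) 0
  simpa [hW.map_zero] using h

end IsUnitaryRep

end UnitaryRep

section Characters

/-- The non-trivial character of `ℤ₂`. -/
def sgn (z : ZMod 2) : ℂ := if z = 0 then 1 else -1

/-- The characters of `ℤ₂^ℤ`. -/
def chi (B : Finset ℤ) (i : ℤ → ZMod 2) : ℂ := ∏ s ∈ B, sgn (i s)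

theorem norm_sgn (z : ZMod 2) : ‖sgn z‖ = 1 := by unfold sgn; split_ifs <;> simp

theorem conj_sgn (z : ZMod 2) : (starRingEnd ℂ) (sgn z) = sgn z := by
  unfold sgn; split_ifs <;> simp

theorem sgn_mul_self (z : ZMod 2) : sgn z * sgn z = 1 := by unfold sgn; split_ifs <;> simp

theorem sgn_one_add (z : ZMod 2) : sgn (1 + z) = -sgn z := by
  have h : z = 0 ∨ z = 1 := by revert z; decide
  rcases h with rfl | rfl <;> simp [sgn, show (1 + 1 : ZMod 2) = 0 from rfl]

theorem norm_chi (B : Finset ℤ) (i : ℤ → ZMod 2) : ‖chi B i‖ = 1 := by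
  simp [chi, norm_prod, norm_sgn]

theorem conj_chi (B : Finset ℤ) (i : ℤ → ZMod 2) : (starRingEnd ℂ) (chi B i) = chi B i := by
  simp [chi, map_prod, conj_sgn]

theorem measurable_chi (B : Finset ℤ) : Measurable (chi B) := by
  refine Finset.measurable_fun_prod _ fun s _ => ?_
  exact (measurable_of_finite sgn).comp (measurable_pi_apply s)

theorem chi_map (B : Finset ℤ) (τ : ℤ ↪ ℤ) (i : ℤ → ZMod 2) :
    chi (B.map τ) i = chi B fun s => i (τ s) :=
  Finset.prod_map _ _ _

theorem chi_single_add (B : Finset ℤ) (s : ℤ) (i : ℤ → ZMod 2) :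
    chi B (Pi.single s 1 + i) = (if s ∈ B then -1 else 1) * chi B i := by
  unfold chi
  have h : ∀ t ∈ B, sgn ((Pi.single s 1 + i : ℤ → ZMod 2) t) =
      (if s = t then -1 else 1) * sgn (i t) := by
    intro t _
    rcases eq_or_ne s t with rfl | hst
    · simp [sgn_one_add]
    · simp [hst]
  rw [Finset.prod_congr rfl h, Finset.prod_mul_distrib]
  congr 1
  rw [Finset.prod_ite_eq]

theorem exists_chi_mul_sgn (B : Finset ℤ) (s : ℤ) :
    ∃ B' : Finset ℤ, ∀ i, chi B' i = chi B i * sgn (i s) := by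
  by_cases hs : s ∈ B
  · refine ⟨B.erase s, fun i => ?_⟩
    rw [chi, chi, ← Finset.mul_prod_erase B _ hs, mul_comm (sgn (i s)), mul_assoc, sgn_mul_self,
      mul_one]
  · exact ⟨insert s B, fun i => by rw [chi, Finset.prod_insert hs, mul_comm]; rfl⟩

theorem exists_indicator_eq_sgn (t : Set (ZMod 2)) :
    ∃ α β : ℂ, ∀ z, t.indicator (1 : ZMod 2 → ℂ) z = α + β * sgn z := by
  refine ⟨(t.indicator 1 0 + t.indicator 1 1) / 2, (t.indicator 1 0 - t.indicator 1 1) / 2,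
    fun z => ?_⟩
  have h : z = 0 ∨ z = 1 := by revert z; decide
  rcases h with rfl | rfl
  · rw [sgn, if_pos rfl]
    ring
  · rw [sgn, if_neg (by decide)]
    ring

variable {X : Type*} [MeasurableSpace X] {μ : Measure X}

theorem memLp_tens (v : Lp ℂ 2 μ) (B : Finset ℤ) :
    MemLp (fun p : X × (ℤ → ZMod 2) => v p.1 * chi B p.2) 2 (μ.prod cubeHaar) := by
  have h := (Lp.memLp v).comp_measurePreserving (measurePreserving_fst (μ := μ) (ν := cubeHaar))
  refine h.of_le (h.aestronglyMeasurable.mul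
    ((measurable_chi B).comp measurable_snd).aestronglyMeasurable) (Eventually.of_forall fun p => ?_)
  rw [norm_mul, norm_chi, mul_one]
  rfl

/-- The tensor product of a function on `X` and a character of `ℤ₂^ℤ`. -/
def tens (v : Lp ℂ 2 μ) (B : Finset ℤ) : Lp ℂ 2 (μ.prod cubeHaar) := (memLp_tens v B).toLp

theorem coeFn_tens (v : Lp ℂ 2 μ) (B : Finset ℤ) :
    tens v B =ᵐ[μ.prod cubeHaar] fun p => v p.1 * chi B p.2 :=
  (memLp_tens v B).coeFn_toLp

theorem tens_empty (v : Lp ℂ 2 μ) :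
    tens v ∅ = koopman Prod.fst (measurePreserving_fst (μ := μ) (ν := cubeHaar)) v := by
  refine Lp.ext ?_
  filter_upwards [coeFn_tens v ∅,
    coeFn_koopman (measurePreserving_fst (μ := μ) (ν := cubeHaar)) v] with p h1 h2
  rw [h1, h2]
  simp [chi]

theorem koopman_tens {f : X → X} (hf : MeasurePreserving f μ μ) (τ : ℤ ↪ ℤ)
    (h : MeasurePreserving (fun p : X × (ℤ → ZMod 2) => (f p.1, fun s => p.2 (τ s)))
      (μ.prod cubeHaar) (μ.prod cubeHaar)) (v : Lp ℂ 2 μ) (B : Finset ℤ) :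
    koopman _ h (tens v B) = tens (koopman f hf v) (B.map τ) := by
  refine Lp.ext ?_
  filter_upwards [coeFn_koopman h (tens v B), h.quasiMeasurePreserving.ae (coeFn_tens v B),
    coeFn_tens (koopman f hf v) (B.map τ),
    (measurePreserving_fst (μ := μ) (ν := cubeHaar)).quasiMeasurePreserving.ae
      (coeFn_koopman hf v)] with p h1 h2 h3 h4
  rw [h1, Function.comp_apply, h2, h3, h4, chi_map]
  rfl

variable [IsProbabilityMeasure μ]

theorem inner_tens_tens_of_ne (v w : Lp ℂ 2 μ) {A B : Finset ℤ} (hAB : A ≠ B) :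
    inner ℂ (tens v A) (tens w B) = 0 := by
  obtain ⟨s, hs⟩ : ∃ s, ¬(s ∈ A ↔ s ∈ B) := by
    by_contra! h
    exact hAB (Finset.ext h)
  have hτ : MeasurePreserving (fun p : X × (ℤ → ZMod 2) => (p.1, Pi.single s 1 + p.2))
      (μ.prod cubeHaar) (μ.prod cubeHaar) :=
    (MeasurePreserving.id μ).prod ⟨by fun_prop, cubeHaar_map_add _⟩
  have key : ∀ (u : Lp ℂ 2 μ) (D : Finset ℤ),
      koopman _ hτ (tens u D) = (if s ∈ D then -1 else 1 : ℂ) • tens u D := by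
    intro u D
    refine Lp.ext ?_
    filter_upwards [coeFn_koopman hτ (tens u D), hτ.quasiMeasurePreserving.ae (coeFn_tens u D),
      coeFn_tens u D, Lp.coeFn_smul (if s ∈ D then -1 else 1 : ℂ) (tens u D)] with p h1 h2 h3 h4
    rw [h1, Function.comp_apply, h2, h4, Pi.smul_apply, h3, chi_single_add, smul_eq_mul]
    ring
  have h := inner_koopman_koopman hτ (tens v A) (tens w B)
  rw [key, key, inner_smul_left, inner_smul_right] at h
  by_cases h1 : s ∈ A <;> by_cases h2 : s ∈ B <;>
    simp only [h1, h2, not_true_eq_false, iff_true, iff_false, not_false_eq_true, iff_self,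
      if_true, if_false] at h hs
  · have : -(inner ℂ (tens v A) (tens w B)) = inner ℂ (tens v A) (tens w B) := by simpa using h
    exact self_eq_neg.1 this.symm
  · have : -(inner ℂ (tens v A) (tens w B)) = inner ℂ (tens v A) (tens w B) := by simpa using h
    exact self_eq_neg.1 this.symm

theorem integral_indicator_mul_chi_eq_zero {F : Lp ℂ 2 (μ.prod cubeHaar)}
    (hF : ∀ (v : Lp ℂ 2 μ) (B : Finset ℤ), inner ℂ (tens v B) F = 0) {E : Set X}
    (hE : MeasurableSet E) (t : ℤ → Set (ZMod 2)) (A : Finset ℤ) (B : Finset ℤ) :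
    ∫ p in E ×ˢ Set.univ, (∏ s ∈ A, (t s).indicator (1 : ZMod 2 → ℂ) (p.2 s)) * chi B p.2 * F p
      ∂(μ.prod cubeHaar) = 0 := by
  have hFi : Integrable F (μ.prod cubeHaar) := (Lp.memLp F).integrable (by norm_num)
  induction A using Finset.induction_on generalizing B with
  | empty =>
    have h := hF (ind μ hE) B
    rw [L2.inner_def] at h
    rw [← integral_indicator (hE.prod MeasurableSet.univ), ← h]
    refine integral_congr_ae ?_
    filter_upwards [coeFn_tens (ind μ hE) B,
      (measurePreserving_fst (μ := μ) (ν := cubeHaar)).quasiMeasurePreserving.ae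
        (indicatorConstLp_coeFn (p := 2) (hs := hE) (hμs := measure_ne_top μ E) (c := (1 : ℂ)))]
      with p h1 h2
    rw [h1, RCLike.inner_apply, map_mul, conj_chi, h2]
    by_cases hp : p.1 ∈ E
    · simp [Set.indicator, hp, mul_comm]
    · simp [Set.indicator, hp]
  | insert s A hs ih =>
    obtain ⟨α, β, hαβ⟩ := exists_indicator_eq_sgn (t s)
    obtain ⟨B', hB'⟩ := exists_chi_mul_sgn B s
    have hint : ∀ D : Finset ℤ, Integrable (fun p : X × (ℤ → ZMod 2) =>
        (∏ s ∈ A, (t s).indicator (1 : ZMod 2 → ℂ) (p.2 s)) * chi D p.2 * F p)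
        ((μ.prod cubeHaar).restrict (E ×ˢ Set.univ)) := by
      intro D
      refine (hFi.bdd_mul (c := 1) ?_ (Eventually.of_forall fun p => ?_)).integrableOn
      · refine Measurable.aestronglyMeasurable (Measurable.mul ?_
          ((measurable_chi D).comp measurable_snd))
        refine Finset.measurable_fun_prod _ fun s _ => ?_
        exact (measurable_of_finite ((t s).indicator (1 : ZMod 2 → ℂ))).comp
          ((measurable_pi_apply (X := fun _ : ℤ => ZMod 2) s).comp measurable_snd)
      · rw [norm_mul, norm_chi, mul_one, norm_prod]
        refine Finset.prod_le_one (fun _ _ => norm_nonneg _) fun s _ => ?_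
        refine (norm_indicator_le_norm_self _ _).trans (by simp)
    have hsum : ∀ p : X × (ℤ → ZMod 2),
        (∏ s ∈ insert s A, (t s).indicator (1 : ZMod 2 → ℂ) (p.2 s)) * chi B p.2 * F p =
        α * ((∏ s ∈ A, (t s).indicator (1 : ZMod 2 → ℂ) (p.2 s)) * chi B p.2 * F p) +
        β * ((∏ s ∈ A, (t s).indicator (1 : ZMod 2 → ℂ) (p.2 s)) * chi B' p.2 * F p) := by
      intro p
      rw [Finset.prod_insert hs, hαβ, hB']
      ring
    simp_rw [hsum]
    rw [integral_add ((hint B).const_mul α) ((hint B').const_mul β), integral_const_mul,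
      integral_const_mul, ih, ih]
    simp

theorem eq_zero_of_inner_tens {F : Lp ℂ 2 (μ.prod cubeHaar)}
    (hF : ∀ (v : Lp ℂ 2 μ) (B : Finset ℤ), inner ℂ (tens v B) F = 0) : F = 0 := by
  have hFi : Integrable F (μ.prod cubeHaar) := (Lp.memLp F).integrable (by norm_num)
  have hgen := generateFrom_eq_prod (C := {s : Set X | MeasurableSet s})
    (D := squareCylinders fun _ : ℤ => {s : Set (ZMod 2) | MeasurableSet s})
    MeasurableSpace.generateFrom_measurableSet
    (generateFrom_squareCylinders (α := fun _ : ℤ => ZMod 2))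
    isCountablySpanning_measurableSet
    ⟨fun _ => Set.univ, fun _ => ⟨∅, fun _ => Set.univ, by simp⟩, Set.iUnion_const _⟩
  have hpi := MeasurableSpace.isPiSystem_measurableSet (α := X) |>.prod
    (isPiSystem_squareCylinders (C := fun _ : ℤ => {s : Set (ZMod 2) | MeasurableSet s})
      (fun _ => MeasurableSpace.isPiSystem_measurableSet) (by simp))
  have hset : ∀ D, MeasurableSet D → ∫ p in D, F p ∂(μ.prod cubeHaar) = 0 := by
    have hbasic : ∀ D ∈ Set.image2 (· ×ˢ ·) {s : Set X | MeasurableSet s}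
        (squareCylinders fun _ : ℤ => {s : Set (ZMod 2) | MeasurableSet s}),
        ∫ p in D, F p ∂(μ.prod cubeHaar) = 0 := by
      rintro _ ⟨E, hE, _, ⟨A, t, _, rfl⟩, rfl⟩
      have hm : MeasurableSet ((A : Set ℤ).pi t) :=
        MeasurableSet.pi A.countable_toSet fun _ _ => MeasurableSet.of_discrete
      have h := integral_indicator_mul_chi_eq_zero hF hE t A ∅
      rw [← integral_indicator (MeasurableSet.prod hE MeasurableSet.univ)] at h
      rw [← integral_indicator (MeasurableSet.prod hE hm), ← h]
      congr 1
      ext p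
      by_cases hp : p.1 ∈ E
      · by_cases hA : ∀ s ∈ A, p.2 s ∈ t s
        · have : ∏ s ∈ A, (t s).indicator (1 : ZMod 2 → ℂ) (p.2 s) = 1 :=
            Finset.prod_eq_one fun s hs => by simp [hA s hs]
          rw [Set.indicator_of_mem
              (show p ∈ E ×ˢ (A : Set ℤ).pi t from ⟨hp, fun s hs => hA s hs⟩),
            Set.indicator_of_mem (Set.mem_prod.2 ⟨hp, Set.mem_univ _⟩), this]
          simp [chi]
        · obtain ⟨s, hs, hst⟩ := by simpa using hA
          have : ∏ s ∈ A, (t s).indicator (1 : ZMod 2 → ℂ) (p.2 s) = 0 :=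
            Finset.prod_eq_zero hs (by simp [hst])
          rw [Set.indicator_of_notMem, Set.indicator_of_mem, this]
          · simp
          · simp [hp]
          · exact fun h => hst (h.2 s hs)
      · simp [Set.indicator, hp]
    intro D hD
    induction D, hD using MeasurableSpace.induction_on_inter hgen.symm hpi with
    | empty => simp
    | basic D hD => exact hbasic D hD
    | compl D hD ih =>
      have huniv := hbasic Set.univ ⟨Set.univ, MeasurableSet.univ, Set.univ,
        ⟨∅, fun _ => Set.univ, by simp⟩, by simp⟩
      have := integral_add_compl hD hFi
      rw [ih, zero_add] at this
      rwa [this, ← setIntegral_univ]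
    | iUnion f hd hm ih =>
      rw [integral_iUnion hm hd hFi.integrableOn]
      simp [ih]
  rw [Lp.eq_zero_iff_ae_eq_zero]
  exact hFi.ae_eq_zero_of_forall_setIntegral_eq_zero fun s hs _ => hset s hs

end Characters

section Extension

variable {X : Type*} [MeasurableSpace X] {μ : Measure X}

section Powers

theorem ipow_zero (S : X ≃ᵐ X) : ipow S 0 = id := by
  unfold ipow
  rw [zpow_zero]
  rfl

theorem ipow_add (S : X ≃ᵐ X) (m n : ℤ) : ipow S (m + n) = ipow S m ∘ ipow S n := by
  unfold ipow
  rw [zpow_add]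
  rfl

theorem ipow_one (S : X ≃ᵐ X) : ipow S 1 = S := by
  unfold ipow
  rw [zpow_one]
  rfl

theorem ipow_comp_ae_eq {T S : X ≃ᵐ X} (hS : MeasurePreserving S μ μ) (hST : ∀ᵐ x ∂μ, S (T x) = T (S x)) (n : ℤ) :
    ∀ᵐ x ∂μ, ipow S n (T x) = T (ipow S n x) := by
  induction n with
  | zero => simp [ipow_zero]
  | succ n ih =>
    filter_upwards [hST, hS.quasiMeasurePreserving.ae ih] with x h1 h2
    rw [ipow_add, ipow_one, Function.comp_apply, Function.comp_apply, h1, h2]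
  | pred n ih =>
    have hS' := ipow_measurePreserving hS (-1)
    have h (x : X) : S (ipow S (-1) x) = x := by
      have := congrFun (ipow_add S 1 (-1)) x
      rw [ipow_one, show (1 : ℤ) + -1 = 0 by norm_num, ipow_zero] at this
      exact this.symm
    have h' (x : X) : ipow S (-1) (S x) = x := by
      have := congrFun (ipow_add S (-1) 1) x
      rw [ipow_one, show (-1 : ℤ) + 1 = 0 by norm_num, ipow_zero] at this
      exact this.symm
    filter_upwards [hS'.quasiMeasurePreserving.ae hST, hS'.quasiMeasurePreserving.ae ih]
      with x h1 h2
    rw [h] at h1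
    rw [sub_eq_add_neg, ipow_add, Function.comp_apply, Function.comp_apply, ← h2, ← h1, h']

theorem imap_comp_T₁ [IsProbabilityMeasure μ] {T S : X ≃ᵐ X} (hS : MeasurePreserving S μ μ) (hST : ∀ᵐ x ∂μ, S (T x) = T (S x)) (φ : X → ZMod 2) (n : ℤ) :
    imap S n ∘ T₁ T S φ =ᵐ[μ.prod cubeHaar] T₂ T S φ ∘ imap S n := by
  filter_upwards [(measurePreserving_fst (μ := μ) (ν := cubeHaar)).quasiMeasurePreserving.ae
    (ipow_comp_ae_eq hS hST n)] with p hp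
  refine Prod.ext hp (funext fun s => ?_)
  change psi S φ p.1 (n + skipOne s) + _ = psi S φ (ipow S n p.1) (skipOne s) + _
  unfold psi
  rw [add_comm n (skipOne s), ipow_add, add_comm (skipOne s) n]
  rfl

theorem isUnitaryRep_ipow {S : X ≃ᵐ X} (hS : MeasurePreserving S μ μ) :
    IsUnitaryRep fun n => koopman (ipow S n) (ipow_measurePreserving hS n) where
  map_zero := by
    rw [koopman_congr _ (MeasurePreserving.id μ) (ipow_zero S).eventuallyEq, koopman_id]
  map_add m n := by
    rw [koopman_comp]
    exact koopman_congr _ _ (by rw [add_comm, ipow_add])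
  inner_map_map n := inner_koopman_koopman _

end Powers

section Shift

/-- The skew shift `(x, i) ↦ (S ^ n x, (i_{n+s})_s)`. -/
def shiftMap (S : X ≃ᵐ X) (n : ℤ) (p : X × (ℤ → ZMod 2)) : X × (ℤ → ZMod 2) :=
  (ipow S n p.1, fun s => p.2 (n + s))

variable [IsProbabilityMeasure μ] {S : X ≃ᵐ X} (hS : MeasurePreserving S μ μ)

include hS in
theorem shiftMap_measurePreserving (n : ℤ) :
    MeasurePreserving (shiftMap S n) (μ.prod cubeHaar) (μ.prod cubeHaar) := by
  have h : MeasurePreserving (fun (i : ℤ → ZMod 2) s => i (n + s)) cubeHaar cubeHaar :=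
    ⟨by fun_prop, Measure.map_infinitePi_infinitePi_of_inj (P := fun _ : ℤ => coin)
      (f := fun s => n + s) (add_right_injective n)⟩
  exact (ipow_measurePreserving hS n).prod h

theorem isUnitaryRep_shiftMap :
    IsUnitaryRep fun n => koopman (shiftMap S n) (shiftMap_measurePreserving hS n) where
  map_zero := by
    rw [koopman_congr _ (MeasurePreserving.id _), koopman_id]
    refine Eventually.of_forall fun p => ?_
    simp [shiftMap, ipow_zero]
  map_add m n := by
    rw [koopman_comp]
    refine koopman_congr _ _ (Eventually.of_forall fun p => ?_)
    simp only [shiftMap, Function.comp_apply, add_comm m n, ipow_add, Prod.mk.injEq, true_and]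
    funext s
    ring_nf
  inner_map_map n := inner_koopman_koopman _

/-- The average of the Koopman operators of the skew shifts. -/
def opShift (a : ℤ → ℝ) : Lp ℂ 2 (μ.prod cubeHaar) →L[ℂ] Lp ℂ 2 (μ.prod cubeHaar) :=
  average a fun n => koopman (shiftMap S n) (shiftMap_measurePreserving hS n)

theorem opJ_eq {a : ℤ → ℝ} (ha : IsWeight a) :
    opJ a S hS = opShift hS a ∘L koopman (imap S 0) (imap_measurePreserving hS 0) := by
  rw [opShift, average_comp ha (fun n => norm_koopman_le _) _ (norm_koopman_le _)]
  change average a _ = _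
  congr 1
  ext1 n
  rw [koopman_comp]
  refine koopman_congr _ _ (Eventually.of_forall fun p => ?_)
  simp [imap, shiftMap, ipow_zero]

theorem opShift_comp_fst {a : ℤ → ℝ} (ha : IsWeight a) (v : Lp ℂ 2 μ) :
    opShift hS a (koopman Prod.fst (measurePreserving_fst (μ := μ) (ν := cubeHaar)) v) =
      koopman Prod.fst (measurePreserving_fst (μ := μ) (ν := cubeHaar)) (opBase a S hS v) := by
  have h := (hasSum_average_apply ha (fun n => norm_koopman_le (ipow_measurePreserving hS n))
    v).mapL (koopman Prod.fst (measurePreserving_fst (μ := μ) (ν := cubeHaar)))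
  refine (hasSum_average_apply ha (fun n => norm_koopman_le _) _).unique (h.congr_fun fun n => ?_)
  rw [map_smul]
  congr 1
  have h1 := congr($(koopman_comp (shiftMap_measurePreserving hS n)
    (measurePreserving_fst (μ := μ) (ν := cubeHaar))) v)
  have h2 := congr($(koopman_comp (measurePreserving_fst (μ := μ) (ν := cubeHaar))
    (ipow_measurePreserving hS n)) v)
  exact h1.trans h2.symm

theorem shift_tens (n : ℤ) (v : Lp ℂ 2 μ) (B : Finset ℤ) :
    koopman (shiftMap S n) (shiftMap_measurePreserving hS n) (tens v B) =
      tens (koopman (ipow S n) (ipow_measurePreserving hS n) v) (B.map (addLeftEmbedding n)) :=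
  koopman_tens (ipow_measurePreserving hS n) (addLeftEmbedding n) (shiftMap_measurePreserving hS n)
    v B

theorem imap_zero_tens (v : Lp ℂ 2 μ) (B : Finset ℤ) :
    koopman (imap S 0) (imap_measurePreserving hS 0) (tens v B) =
      tens v (B.map ⟨skipOne, skipOne_injective⟩) := by
  have h : imap S 0 = fun p : X × (ℤ → ZMod 2) => (id p.1, fun s => p.2 (skipOne s)) := by
    funext p
    simp [imap, ipow_zero]
  have hm := h ▸ imap_measurePreserving hS 0
  rw [koopman_congr _ hm h.eventuallyEq]
  have := koopman_tens (MeasurePreserving.id μ) ⟨skipOne, skipOne_injective⟩ hm v B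
  rwa [koopman_id] at this

theorem map_addLeft_ne {B : Finset ℤ} (hB : B.Nonempty) {n : ℤ} (hn : n ≠ 0) :
    B.map (addLeftEmbedding n) ≠ B := by
  intro h
  have h1 := congrArg (fun D : Finset ℤ => ∑ s ∈ D, s) h
  simp only [Finset.sum_map, addLeftEmbedding_apply] at h1
  rw [Finset.sum_add_distrib, Finset.sum_const, nsmul_eq_mul, add_eq_right, mul_eq_zero,
    Nat.cast_eq_zero, Finset.card_eq_zero] at h1
  exact h1.elim hB.ne_empty hn

theorem inner_shift_tens {B : Finset ℤ} (hB : B.Nonempty) (v : Lp ℂ 2 μ) (n : ℤ) (hn : n ≠ 0) :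
    inner ℂ (koopman (shiftMap S n) (shiftMap_measurePreserving hS n) (tens v B)) (tens v B) =
      0 := by
  rw [shift_tens hS]
  exact inner_tens_tens_of_ne _ _ (map_addLeft_ne hB hn)

variable {a : ℤ → ℝ} (ha : IsAdmissible a) (hinj : Function.Injective (opBase a S hS))
include ha hinj

theorem inner_tens_empty_eq_zero {F : Lp ℂ 2 (μ.prod cubeHaar)}
    (hF : ∀ w : Lp ℂ 2 μ, inner ℂ (opShift hS a (tens w ∅)) F = 0) (v : Lp ℂ 2 μ) :
    inner ℂ (tens v ∅) F = 0 := by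
  rw [tens_empty, ← ContinuousLinearMap.adjoint_inner_right]
  set π := koopman Prod.fst (measurePreserving_fst (μ := μ) (ν := cubeHaar))
  suffices h : ContinuousLinearMap.adjoint π F = 0 by rw [h, inner_zero_right]
  refine (injective_iff_map_eq_zero _).1
    ((isUnitaryRep_ipow hS).injective_adjoint_average ha.isWeight hinj) _ ?_
  refine ext_inner_left ℂ fun w => ?_
  rw [ContinuousLinearMap.adjoint_inner_right, ContinuousLinearMap.adjoint_inner_right,
    inner_zero_right]
  have h := hF w
  rw [tens_empty, opShift_comp_fst hS ha.isWeight] at h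
  exact h

theorem injective_opJ : Function.Injective (opJ a S hS) := by
  rw [opJ_eq hS ha.isWeight]
  rw [ContinuousLinearMap.coe_comp]
  refine Function.Injective.comp ?_ (koopman_injective (imap_measurePreserving hS 0))
  rw [injective_iff_map_eq_zero]
  intro F hF
  refine eq_zero_of_inner_tens fun v B => ?_
  rcases B.eq_empty_or_nonempty with rfl | hB
  · refine inner_tens_empty_eq_zero hS ha hinj (fun w => ?_) v
    rw [← ContinuousLinearMap.adjoint_inner_right, opShift,
      ((isUnitaryRep_shiftMap hS).adjoint_average_apply_eq_zero_iff ha.isWeight F).2 hF,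
      inner_zero_right]
  · exact (isUnitaryRep_shiftMap hS).inner_eq_zero_of_average_eq_zero ha
      (inner_shift_tens hS hB v) hF

theorem injective_adjoint_opJ :
    Function.Injective (ContinuousLinearMap.adjoint (opJ a S hS)) := by
  rw [injective_iff_map_eq_zero]
  intro F hF
  have hJ : ∀ G, inner ℂ (opJ a S hS G) F = 0 := fun G => by
    rw [← ContinuousLinearMap.adjoint_inner_right, hF, inner_zero_right]
  refine eq_zero_of_inner_tens fun v B => ?_
  rcases B.eq_empty_or_nonempty with rfl | hB
  · refine inner_tens_empty_eq_zero hS ha hinj (fun w => ?_) v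
    have h := hJ (tens w ∅)
    rwa [opJ_eq hS ha.isWeight, ContinuousLinearMap.comp_apply, imap_zero_tens hS,
      Finset.map_empty] at h
  · refine (isUnitaryRep_shiftMap hS).inner_eq_zero_of_inner_average ha
      (inner_shift_tens hS hB v) ?_
    refine (Finset.finite_toSet (B.image fun s => 1 - s)).subset fun m hm => ?_
    by_contra hmB
    refine hm ?_
    rw [shift_tens hS]
    have h1 : ∀ s ∈ B.map (addLeftEmbedding m), s ≠ 1 := by
      rintro _ hs rfl
      obtain ⟨t, ht, hmt⟩ := Finset.mem_map.1 hs
      refine hmB (Finset.mem_coe.2 (Finset.mem_image.2 ⟨t, ht, ?_⟩))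
      have : m + t = 1 := hmt
      omega
    obtain ⟨A, hA⟩ : ∃ A : Finset ℤ,
        A.map ⟨skipOne, skipOne_injective⟩ = B.map (addLeftEmbedding m) := by
      have : (B.map (addLeftEmbedding m) : Set ℤ) ⊆ Set.range skipOne := by
        intro s hs
        have := h1 s hs
        by_cases h : s ≤ 0
        · exact ⟨s, if_pos h⟩
        · exact ⟨s - 1, by unfold skipOne; split_ifs <;> omega⟩
      obtain ⟨A, _, hA⟩ := Finset.subset_set_image_iff.1 (by rwa [← Set.image_univ] at this)
      exact ⟨A, by rw [← hA, Finset.map_eq_image]; rfl⟩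
    have h := hJ (tens (koopman (ipow S m) (ipow_measurePreserving hS m) v) A)
    rw [opJ_eq hS ha.isWeight, ContinuousLinearMap.comp_apply, imap_zero_tens hS, hA] at h
    exact h

end Shift

section Dense

variable {H : Type*} [NormedAddCommGroup H] [InnerProductSpace ℂ H] [CompleteSpace H]

theorem denseRange_of_injective_adjoint {Φ : H →L[ℂ] H}
    (h : Function.Injective (ContinuousLinearMap.adjoint Φ)) : DenseRange Φ := by
  have hk : (Φ.range)ᗮ = ⊥ := by
    rw [ContinuousLinearMap.orthogonal_range]
    exact LinearMap.ker_eq_bot.2 h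
  have := Submodule.topologicalClosure_eq_top_iff.2 hk
  exact Submodule.dense_iff_topologicalClosure_eq_top.2 this

end Dense

section Intertwining

variable [IsProbabilityMeasure μ] {T S : X ≃ᵐ X} (hT : MeasurePreserving T μ μ)
  (hS : MeasurePreserving S μ μ) (hST : ∀ᵐ x ∂μ, S (T x) = T (S x)) {φ : X → ZMod 2}
  (hφ : Measurable φ) {a : ℤ → ℝ} (ha : IsWeight a)

include hST ha in
theorem koopman_T₁_comp_opJ :
    koopman (T₁ T S φ) (T₁_measurePreserving hT hS hφ) ∘L opJ a S hS =
      opJ a S hS ∘L koopman (T₂ T S φ) (T₂_measurePreserving hT hS hφ) := by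
  change _ ∘L average a _ = average a _ ∘L _
  rw [comp_average ha (fun n => norm_koopman_le _) _ (norm_koopman_le _),
    average_comp ha (fun n => norm_koopman_le _) _ (norm_koopman_le _)]
  congr 1
  ext1 n
  rw [koopman_comp, koopman_comp]
  exact koopman_congr _ _ (imap_comp_T₁ hS hST φ n)

theorem koopman_comp_adjoint_of_rightInverse {Ω : Type*} [MeasurableSpace Ω] {ν : Measure Ω}
    {f g : Ω → Ω} (hf : MeasurePreserving f ν ν) (hg : MeasurePreserving g ν ν)
    (hgf : Function.LeftInverse g f) :
    koopman f hf ∘L ContinuousLinearMap.adjoint (koopman f hf) =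
      ContinuousLinearMap.id ℂ (Lp ℂ 2 ν) := by
  have h1 : koopman f hf ∘L koopman g hg = ContinuousLinearMap.id ℂ (Lp ℂ 2 ν) := by
    rw [koopman_comp, koopman_congr _ (MeasurePreserving.id ν), koopman_id]
    exact Eventually.of_forall hgf
  have h2 : ContinuousLinearMap.adjoint (koopman f hf) = koopman g hg := by
    symm
    rw [ContinuousLinearMap.eq_adjoint_iff]
    intro F G
    rw [← inner_koopman_koopman hf]
    congr 1
    exact congr($h1 F)
  rw [h2, h1]

theorem koopman_T₂_comp_adjoint :
    koopman (T₂ T S φ) (T₂_measurePreserving hT hS hφ) ∘L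
      ContinuousLinearMap.adjoint (koopman (T₂ T S φ) (T₂_measurePreserving hT hS hφ)) =
      ContinuousLinearMap.id ℂ (Lp ℂ 2 (μ.prod cubeHaar)) := by
  have hψ : Measurable fun x s => psi S φ x (skipOne s) :=
    measurable_pi_lambda _ fun s =>
      (measurable_pi_apply (skipOne s)).comp (psi_measurable hS hφ)
  refine koopman_comp_adjoint_of_rightInverse _
    (groupExtension_measurePreserving (T := T.symm) (hT.symm T)
      (ψ := fun x => -(fun s => psi S φ (T.symm x) (skipOne s)))
      (hψ.comp T.symm.measurable).neg) fun p => ?_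
  refine Prod.ext (T.symm_apply_apply p.1) ?_
  simp [groupExtension, T₂]

include hST ha in
theorem koopman_T₂_comp_adjoint_opJ :
    koopman (T₂ T S φ) (T₂_measurePreserving hT hS hφ) ∘L
        ContinuousLinearMap.adjoint (opJ a S hS) =
      ContinuousLinearMap.adjoint (opJ a S hS) ∘L
        koopman (T₁ T S φ) (T₁_measurePreserving hT hS hφ) := by
  have h := congrArg ContinuousLinearMap.adjoint (koopman_T₁_comp_opJ hT hS hST hφ ha)
  rw [ContinuousLinearMap.adjoint_comp, ContinuousLinearMap.adjoint_comp] at h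
  have h1 : ContinuousLinearMap.adjoint (koopman (T₁ T S φ) (T₁_measurePreserving hT hS hφ)) ∘L
      koopman (T₁ T S φ) (T₁_measurePreserving hT hS hφ) =
      ContinuousLinearMap.id ℂ (Lp ℂ 2 (μ.prod cubeHaar)) := by
    refine ContinuousLinearMap.ext fun F => ext_inner_left ℂ fun G => ?_
    rw [ContinuousLinearMap.comp_apply, ContinuousLinearMap.adjoint_inner_right,
      inner_koopman_koopman]
    rfl
  have h2 := congrArg (fun L => koopman (T₂ T S φ) (T₂_measurePreserving hT hS hφ) ∘L L ∘L
    koopman (T₁ T S φ) (T₁_measurePreserving hT hS hφ)) h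
  simp only [ContinuousLinearMap.comp_assoc, h1, ContinuousLinearMap.comp_id] at h2
  rw [h2, ← ContinuousLinearMap.comp_assoc, koopman_T₂_comp_adjoint hT hS hφ,
    ContinuousLinearMap.id_comp]

end Intertwining

end Extension

section Lacunary

open Real Topology

/-- The lacunary cosine series `∑ₖ 16⁻ᵏ cos (2π 64ᵏ x)`. -/
def lacunary (x : ℝ) : ℝ := ∑' k : ℕ, (1 / 16 : ℝ) ^ k * cos (2 * π * 64 ^ k * x)

theorem norm_lacunary_term_le (k : ℕ) (x : ℝ) :
    ‖(1 / 16 : ℝ) ^ k * cos (2 * π * 64 ^ k * x)‖ ≤ (1 / 16 : ℝ) ^ k := by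
  rw [norm_mul, norm_of_nonneg (by positivity)]
  exact mul_le_of_le_one_right (by positivity) (abs_cos_le_one _)

theorem hasSum_geometric_sixteenth : HasSum (fun k : ℕ => (1 / 16 : ℝ) ^ k) (16 / 15) := by
  convert hasSum_geometric_of_lt_one (r := (1 / 16 : ℝ)) (by norm_num) (by norm_num) using 1
  norm_num

theorem hasSum_lacunary (x : ℝ) :
    HasSum (fun k : ℕ => (1 / 16 : ℝ) ^ k * cos (2 * π * 64 ^ k * x)) (lacunary x) :=
  (hasSum_geometric_sixteenth.summable.of_norm_bounded fun k => norm_lacunary_term_le k x).hasSum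

theorem continuous_lacunary : Continuous lacunary :=
  continuous_tsum (fun k => by fun_prop) hasSum_geometric_sixteenth.summable norm_lacunary_term_le

theorem lacunary_zero : lacunary 0 = 16 / 15 := by
  refine (hasSum_lacunary 0).unique ?_
  simpa using hasSum_geometric_sixteenth

theorem lacunary_half : lacunary (1 / 2) = -14 / 15 := by
  have h0 := hasSum_lacunary (1 / 2)
  have h1 : HasSum (fun k : ℕ => (1 / 16 : ℝ) ^ k + if k = 0 then -2 else 0) (16 / 15 + -2) :=
    hasSum_geometric_sixteenth.add (hasSum_ite_eq 0 (-2 : ℝ))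
  convert h0.unique (h1.congr_fun fun k => ?_) using 1
  · norm_num
  · rcases k with _ | k
    · rw [show 2 * π * 64 ^ 0 * (1 / 2) = π by ring, cos_pi]
      norm_num
    · rw [show 2 * π * 64 ^ (k + 1) * (1 / 2) = ((32 * 64 ^ k : ℕ) : ℝ) * (2 * π) by
        push_cast; ring, cos_nat_mul_two_pi]
      simp

theorem abs_cos_sub_cos_le_sqrt (u v : ℝ) : |cos u - cos v| ≤ √(2 * |u - v|) := by
  refine abs_le_sqrt ?_
  have h1 : |cos u - cos v| ≤ |u - v| := abs_cos_sub_cos_le u v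
  have h2 : |cos u - cos v| ≤ 2 := by
    have := abs_sub (cos u) (cos v)
    linarith [abs_cos_le_one u, abs_cos_le_one v]
  rw [← sq_abs, sq]
  exact mul_le_mul h2 h1 (abs_nonneg _) (by norm_num)

theorem exists_abs_lacunary_sub_le :
    ∃ C : ℝ, 0 < C ∧ ∀ x y, |lacunary x - lacunary y| ≤ C * √|x - y| := by
  refine ⟨√(4 * π) * 2, by positivity, fun x y => ?_⟩
  have hg : HasSum (fun k : ℕ => (1 / 2 : ℝ) ^ k) 2 := hasSum_geometric_two
  have h := ((hasSum_lacunary x).sub (hasSum_lacunary y)).tsum_eq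
  rw [← h, ← norm_eq_abs, mul_right_comm]
  refine tsum_of_norm_bounded (hg.mul_left (√(4 * π) * √|x - y|)) fun k => ?_
  rw [← mul_sub, norm_mul, norm_of_nonneg (by positivity), norm_eq_abs]
  calc (1 / 16 : ℝ) ^ k * |cos (2 * π * 64 ^ k * x) - cos (2 * π * 64 ^ k * y)|
      ≤ (1 / 16 : ℝ) ^ k * √(2 * |2 * π * 64 ^ k * x - 2 * π * 64 ^ k * y|) := by
        gcongr
        exact abs_cos_sub_cos_le_sqrt _ _
    _ = (1 / 16 : ℝ) ^ k * (√(4 * π) * √|x - y| * 8 ^ k) := by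
        congr 1
        rw [← mul_sub, abs_mul, abs_of_pos (by positivity),
          show 2 * (2 * π * 64 ^ k * |x - y|) = 4 * π * |x - y| * (8 ^ k) ^ 2 by
            rw [← pow_mul, mul_comm k, pow_mul]; norm_num; ring,
          sqrt_mul (by positivity), sqrt_sq (by positivity), sqrt_mul (by positivity)]
    _ = √(4 * π) * √|x - y| * (1 / 2) ^ k := by
        rw [mul_left_comm, ← mul_pow]
        norm_num

theorem lacunary_lt_of_abs_eq {k : ℕ} (i : ℤ) {δ : ℝ} (hδ : |δ| = 1 / (2 * 64 ^ k)) :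
    lacunary (i / 64 ^ k + δ) < lacunary (i / 64 ^ k) := by
  set p : ℝ := i / 64 ^ k
  have h := (hasSum_lacunary (p + δ)).sub (hasSum_lacunary p)
  have h64 : (64 : ℝ) ^ k ≠ 0 := by positivity
  have hcos : ∀ (u : ℝ) (m : ℕ), cos (u + m * (2 * π) * i) = cos u := fun u m => by
    have := cos_add_int_mul_two_pi u (m * i)
    push_cast at this
    rw [← this]
    ring_nf
  have hcosδ : ∀ u : ℝ, cos (u * δ) = cos (u * |δ|) := fun u => by
    rcases abs_choice δ with h | h <;> rw [h]
    rw [mul_neg, cos_neg]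
  have hge : ∀ m : ℕ, ∀ u : ℝ, cos (2 * π * 64 ^ (k + m) * (p + u)) =
      cos (2 * π * 64 ^ (k + m) * u) := fun m u => by
    rw [← hcos (2 * π * 64 ^ (k + m) * u) (64 ^ m)]
    congr 1
    simp only [p]
    push_cast
    field_simp
    ring
  have hzero : ∀ j ∉ Finset.range (k + 1),
      (1 / 16 : ℝ) ^ j * cos (2 * π * 64 ^ j * (p + δ)) -
        (1 / 16 : ℝ) ^ j * cos (2 * π * 64 ^ j * p) = 0 := by
    intro j hj
    obtain ⟨m, rfl⟩ : ∃ m, j = k + (m + 1) := ⟨j - k - 1, by simp at hj; omega⟩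
    have h1 := hge (m + 1) 0
    rw [add_zero, mul_zero, cos_zero] at h1
    rw [hge, h1, hcosδ, hδ, show 2 * π * 64 ^ (k + (m + 1)) * (1 / (2 * 64 ^ k)) =
      ((32 * 64 ^ m : ℕ) : ℝ) * (2 * π) by push_cast; field_simp; ring, cos_nat_mul_two_pi]
    ring
  have hsum := h.unique (hasSum_sum_of_ne_finset_zero hzero)
  rw [Finset.sum_range_succ] at hsum
  have hk : (1 / 16 : ℝ) ^ k * cos (2 * π * 64 ^ k * (p + δ)) -
      (1 / 16 : ℝ) ^ k * cos (2 * π * 64 ^ k * p) = -2 * (1 / 16) ^ k := by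
    have h1 := hge 0 0
    have h2 := hge 0 δ
    rw [add_zero] at h1 h2
    rw [add_zero, mul_zero, cos_zero] at h1
    rw [h1, h2, hcosδ, hδ, show 2 * π * 64 ^ k * (1 / (2 * 64 ^ k)) = π by field_simp, cos_pi]
    ring
  have hlt : ∑ j ∈ Finset.range k, ((1 / 16 : ℝ) ^ j * cos (2 * π * 64 ^ j * (p + δ)) -
        (1 / 16 : ℝ) ^ j * cos (2 * π * 64 ^ j * p)) ≤
      ∑ j ∈ Finset.range k, π / 64 ^ k * 4 ^ j := by
    refine Finset.sum_le_sum fun j _ => ?_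
    have h1 := (le_abs_self _).trans
      (abs_cos_sub_cos_le (2 * π * 64 ^ j * (p + δ)) (2 * π * 64 ^ j * p))
    rw [← mul_sub, add_sub_cancel_left, abs_mul, hδ, abs_of_pos (by positivity)] at h1
    rw [← mul_sub]
    refine (mul_le_mul_of_nonneg_left h1 (by positivity)).trans_eq ?_
    have h4 : (4 : ℝ) ^ j = (1 / 16) ^ j * 64 ^ j := by rw [← mul_pow]; norm_num
    rw [h4]
    field_simp
  have hgeom : ∑ j ∈ Finset.range k, π / 64 ^ k * 4 ^ j < 2 * (1 / 16) ^ k := by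
    rw [← Finset.mul_sum, geom_sum_eq (by norm_num)]
    have h4 : (1 / 16 : ℝ) ^ k = 4 ^ k / 64 ^ k := by rw [← div_pow]; norm_num
    have hπ := pi_lt_four
    have hπ0 := pi_pos
    have h4k : (0 : ℝ) < 4 ^ k := by positivity
    have : π * ((4 ^ k - 1) / (4 - 1)) ≤ 4 * (4 ^ k / 3) := by
      refine mul_le_mul hπ.le (by linarith) ?_ (by norm_num)
      have : (1 : ℝ) ≤ 4 ^ k := one_le_pow₀ (by norm_num)
      exact div_nonneg (by linarith) (by norm_num)
    have h64' : (0 : ℝ) < 64 ^ k := by positivity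
    calc π / 64 ^ k * ((4 ^ k - 1) / (4 - 1)) = π * ((4 ^ k - 1) / (4 - 1)) / 64 ^ k := by ring
      _ < 2 * 4 ^ k / 64 ^ k := (div_lt_div_iff_of_pos_right h64').2 (by linarith)
      _ = 2 * (1 / 16) ^ k := by rw [h4, mul_div_assoc]
  linarith

/-- The levels which are crossed upwards and then downwards between `u` and `v`. -/
def hatLevels (u v : ℝ) : Set ℝ :=
  {t | ∃ x y z, u < x ∧ x < y ∧ y < z ∧ z < v ∧ lacunary x < t ∧ t < lacunary y ∧ lacunary z < t}

theorem isOpen_hatLevels (u v : ℝ) : IsOpen (hatLevels u v) := by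
  rw [isOpen_iff_mem_nhds]
  rintro t ⟨x, y, z, h1, h2, h3, h4, h5, h6, h7⟩
  filter_upwards [lt_mem_nhds h5, gt_mem_nhds h6, lt_mem_nhds h7] with s h5 h6 h7
  exact ⟨x, y, z, h1, h2, h3, h4, h5, h6, h7⟩

theorem lacunary_mem_closure_hatLevels {u v x : ℝ} (hu : u < x) (hv : x < v) :
    lacunary x ∈ closure (hatLevels u v) := by
  rw [Metric.mem_closure_iff]
  intro ε hε
  obtain ⟨δ, hδ, hcont⟩ := Metric.continuous_iff.1 continuous_lacunary x ε hε
  obtain ⟨η, hη, hη1, hη2, hη3⟩ : ∃ η > 0, η ≤ δ ∧ η ≤ x - u ∧ η ≤ v - x :=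
    ⟨min δ (min (x - u) (v - x)), by simp [hδ, hu, hv], by simp, by simp, by simp⟩
  obtain ⟨k, hk⟩ := exists_pow_lt_of_lt_one (y := (1 / 64 : ℝ)) (half_pos hη) (by norm_num)
  rw [div_pow, one_pow] at hk
  have h64 : (0 : ℝ) < 64 ^ k := by positivity
  set d : ℝ := 1 / (2 * 64 ^ k) with hd
  have hd0 : 0 < d := by positivity
  have hd2 : 1 / 64 ^ k = 2 * d := by rw [hd]; field_simp
  set i : ℤ := ⌊x * 64 ^ k⌋
  set p : ℝ := i / 64 ^ k with hp
  have hp1 : p ≤ x := by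
    rw [hp, div_le_iff₀ h64]
    exact Int.floor_le _
  have hp2 : x < p + 2 * d := by
    rw [← hd2, hp, ← add_div, lt_div_iff₀ h64]
    exact Int.lt_floor_add_one _
  have habs : |d| = 1 / (2 * 64 ^ k) := abs_of_pos hd0
  have hl := lacunary_lt_of_abs_eq i (δ := -d) (by rw [abs_neg]; exact habs)
  have hr := lacunary_lt_of_abs_eq i habs
  rw [← hp] at hl hr
  have near : ∀ y, |y - x| < η → |lacunary y - lacunary x| < ε := fun y hy =>
    hcont y (hy.trans_le hη1)
  have n1 := abs_lt.1 (near p (by rw [abs_lt]; constructor <;> linarith))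
  have n2 := abs_lt.1 (near (p + -d) (by rw [abs_lt]; constructor <;> linarith))
  have n3 := abs_lt.1 (near (p + d) (by rw [abs_lt]; constructor <;> linarith))
  obtain ⟨t, ht1, ht2⟩ := exists_between (max_lt hl hr)
  obtain ⟨ht3, ht4⟩ := max_lt_iff.1 ht1
  refine ⟨t, ⟨p + -d, p, p + d, by linarith, by linarith, by linarith, by linarith, ht3, ht2,
    ht4⟩, ?_⟩
  rw [Real.dist_eq, abs_lt]
  constructor <;> linarith

theorem exists_level {C : Set ℝ} (hC : C.Countable) :
    ∃ t ∈ Set.Ioo (-14 / 15 : ℝ) 0, t ∉ C ∧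
      ∀ x, lacunary x = t → ∃ᶠ y in 𝓝[≠] x, lacunary y = t := by
  have hres : ((⋃ q : ℚ × ℚ, frontier (hatLevels q.1 q.2)) ∪ ⋃ c ∈ C, {c})ᶜ ∈ residual ℝ := by
    refine IsMeagre.union (isMeagre_iUnion fun q => ?_) (isMeagre_biUnion hC fun c _ => ?_)
    · refine (isClosed_frontier.isNowhereDense_iff.2 ?_).isMeagre
      rw [← frontier_compl]
      exact interior_frontier (isOpen_hatLevels _ _).isClosed_compl
    · exact (isClosed_singleton.isNowhereDense_iff.2 (interior_singleton c)).isMeagre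
  obtain ⟨t, ht, htr⟩ := (dense_of_mem_residual hres).inter_open_nonempty
    (Set.Ioo (-14 / 15 : ℝ) 0) isOpen_Ioo ⟨-1 / 2, by norm_num, by norm_num⟩
  simp only [Set.compl_union, Set.mem_inter_iff, Set.mem_compl_iff, Set.mem_iUnion, not_exists,
    Set.mem_singleton_iff] at htr
  refine ⟨t, ht, fun htC => htr.2 t htC rfl, fun x hx => ?_⟩
  rw [frequently_nhdsWithin_iff, Metric.nhds_basis_ball.frequently_iff]
  intro ε hε
  obtain ⟨u, hu1, hu2⟩ := exists_rat_btwn (sub_lt_self x hε)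
  obtain ⟨v, hv1, hv2⟩ := exists_rat_btwn (lt_add_of_pos_right x hε)
  have hmem : t ∈ hatLevels u v := by
    have hcl := lacunary_mem_closure_hatLevels hu2 hv1
    rw [hx, closure_eq_self_union_frontier] at hcl
    exact hcl.resolve_right (htr.1 (u, v))
  obtain ⟨a, b, c, h1, h2, h3, h4, h5, h6, h7⟩ := hmem
  obtain ⟨y, hy, hyt⟩ := intermediate_value_Ioo h2.le continuous_lacunary.continuousOn ⟨h5, h6⟩
  obtain ⟨z, hz, hzt⟩ := intermediate_value_Ioo' h3.le continuous_lacunary.continuousOn ⟨h7, h6⟩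
  have hball : ∀ w, a < w → w < c → w ∈ Metric.ball x ε := fun w hw1 hw2 => by
    rw [Metric.mem_ball, Real.dist_eq, abs_lt]
    constructor <;> linarith
  by_cases hyx : y = x
  · exact ⟨z, hball z (h2.trans hz.1) hz.2, hzt, fun h : z = x => by
      have := hy.2.trans hz.1
      rw [hyx, h] at this
      exact lt_irrefl _ this⟩
  · exact ⟨y, hball y hy.1 (hy.2.trans h3), hyt, hyx⟩

theorem exists_lacunary_eq {t : ℝ} (ht : t ∈ Set.Ioo (-14 / 15 : ℝ) 0) :
    ∃ x ∈ Set.Ioo (0 : ℝ) 1, lacunary x = t := by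
  obtain ⟨x, hx, hxt⟩ := intermediate_value_Ioo' (a := 0) (b := 1 / 2) (by norm_num)
    continuous_lacunary.continuousOn (show t ∈ _ by
      rw [lacunary_zero, lacunary_half]
      exact ⟨ht.1, by linarith [ht.2]⟩)
  exact ⟨x, ⟨hx.1, by linarith [hx.2]⟩, hxt⟩

end Lacunary

section Weights

open Real

/-- The positive frequencies of `lacunary`. -/
def halfWeight : ℤ → ℝ :=
  Function.extend (fun k : ℕ => (64 : ℤ) ^ k) (fun k => 1 / 2 * (1 / 16 : ℝ) ^ k) 0

/-- The Fourier coefficients of `(lacunary - t) / (16 / 15 - t)`. -/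
def weight (t : ℝ) (n : ℤ) : ℝ :=
  (halfWeight n + halfWeight (-n) - if n = 0 then t else 0) / (16 / 15 - t)

theorem pow_sixtyFour_injective : Function.Injective fun k : ℕ => (64 : ℤ) ^ k :=
  Int.pow_right_injective (by norm_num)

theorem halfWeight_nonneg (n : ℤ) : 0 ≤ halfWeight n := by
  unfold halfWeight
  by_cases h : ∃ k : ℕ, (64 : ℤ) ^ k = n
  · obtain ⟨k, rfl⟩ := h
    rw [pow_sixtyFour_injective.extend_apply]
    positivity
  · rw [Function.extend_apply' _ _ _ h]
    rfl

theorem hasSum_halfWeight_mul {v : ℤ → ℂ} {s : ℂ}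
    (h : HasSum (fun k : ℕ => ((1 / 2 * (1 / 16 : ℝ) ^ k : ℝ) : ℂ) * v (64 ^ k)) s) :
    HasSum (fun n => (halfWeight n : ℂ) * v n) s := by
  rw [← hasSum_extend_zero pow_sixtyFour_injective] at h
  refine h.congr_fun fun n => ?_
  unfold halfWeight
  by_cases h : ∃ k : ℕ, (64 : ℤ) ^ k = n
  · obtain ⟨k, rfl⟩ := h
    rw [pow_sixtyFour_injective.extend_apply, pow_sixtyFour_injective.extend_apply]
  · rw [Function.extend_apply' _ _ _ h, Function.extend_apply' _ _ _ h]
    simp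

theorem hasSum_halfWeight : HasSum halfWeight (8 / 15) := by
  refine (hasSum_extend_zero pow_sixtyFour_injective).2 ?_
  have h := hasSum_geometric_sixteenth.mul_left (1 / 2)
  rwa [show (1 / 2 * (16 / 15) : ℝ) = 8 / 15 by norm_num] at h

theorem isWeight_weight {t : ℝ} (ht : t ≤ 0) : IsWeight (weight t) where
  nonneg n := by
    refine div_nonneg (sub_nonneg.2 ?_) (by linarith)
    refine le_trans ?_ (add_nonneg (halfWeight_nonneg n) (halfWeight_nonneg (-n)))
    split_ifs
    exacts [ht, le_rfl]
  hasSum := by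
    have h2 := (Equiv.neg ℤ).hasSum_iff.2 hasSum_halfWeight
    have h3 := ((hasSum_halfWeight.add h2).sub (hasSum_ite_eq 0 t)).div_const (16 / 15 - t)
    rwa [show (8 / 15 + 8 / 15 - t : ℝ) = 16 / 15 - t by ring, div_self (by linarith)] at h3

theorem weight_neg (t : ℝ) (n : ℤ) : weight t (-n) = weight t n := by
  simp only [weight, neg_neg, neg_eq_zero, add_comm]

theorem hasSum_weight_fourier (t x : ℝ) :
    HasSum (fun n : ℤ => (weight t n : ℂ) * fourier n (x : UnitAddCircle))
      (((lacunary x - t) / (16 / 15 - t) : ℝ) : ℂ) := by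
  set e : ℤ → ℂ := fun n => fourier n (x : UnitAddCircle)
  have he : ∀ n, ‖e n‖ ≤ 1 := fun n => by
    simp only [e, fourier_apply, Circle.norm_coe, le_refl]
  have hs : ∀ m : ℕ → ℤ, Summable fun k : ℕ => ((1 / 2 * (1 / 16 : ℝ) ^ k : ℝ) : ℂ) * e (m k) := by
    intro m
    refine (hasSum_geometric_sixteenth.summable.mul_left (1 / 2)).of_norm_bounded fun k => ?_
    rw [norm_mul, Complex.norm_real, norm_of_nonneg (by positivity)]
    exact mul_le_of_le_one_right (by positivity) (he _)
  have h1 := (hs fun k => 64 ^ k).hasSum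
  have h2 := (hs fun k => -64 ^ k).hasSum
  have h12 : (∑' k : ℕ, ((1 / 2 * (1 / 16 : ℝ) ^ k : ℝ) : ℂ) * e (64 ^ k)) +
      (∑' k : ℕ, ((1 / 2 * (1 / 16 : ℝ) ^ k : ℝ) : ℂ) * e (-64 ^ k)) = (lacunary x : ℂ) := by
    refine (h1.add h2).unique ((Complex.hasSum_ofReal.2 (hasSum_lacunary x)).congr_fun fun k => ?_)
    have hexp : e (64 ^ k) = Complex.exp ((2 * π * 64 ^ k * x : ℝ) * Complex.I) := by
      simp only [e]
      rw [fourier_coe_apply]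
      push_cast
      ring_nf
    have hneg : e (-64 ^ k) = (starRingEnd ℂ) (e (64 ^ k)) := fourier_neg
    rw [← mul_add, hneg, Complex.add_conj, hexp, Complex.exp_ofReal_mul_I_re]
    push_cast
    ring
  have h3 := hasSum_halfWeight_mul (v := e) h1
  have h4 := (Equiv.neg ℤ).hasSum_iff.2 (hasSum_halfWeight_mul (v := fun n => e (-n)) h2)
  have h5 := ((h3.add h4).sub (hasSum_ite_eq 0 (t : ℂ))).div_const ((16 / 15 - t : ℝ) : ℂ)
  rw [h12, ← Complex.ofReal_sub, ← Complex.ofReal_div] at h5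
  refine h5.congr_fun fun n => ?_
  have h0 : e 0 = 1 := fourier_zero
  change (weight t n : ℂ) * e n = _
  clear_value e
  simp only [weight, Function.comp_apply, Equiv.neg_apply, neg_neg]
  split_ifs with hn
  · rw [hn, h0]
    push_cast
    ring
  · push_cast
    ring

end Weights

section Spectrum

variable {H : Type*} [NormedAddCommGroup H] [InnerProductSpace ℂ H] [CompleteSpace H]

theorem average_weight_zero_apply {W : ℤ → H →L[ℂ] H} (hW : IsUnitaryRep W) {t : ℝ}
    (ht : t ≤ 0) {f : H} (hf : average (weight t) W f = 0) :
    average (weight 0) W f = ((15 / 16 * t : ℝ) : ℂ) • f := by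
  have h1 := (hasSum_average_apply (isWeight_weight ht) hW.norm_le f).const_smul
    (((16 / 15 - t) * (15 / 16) : ℝ) : ℂ)
  have h2 := hasSum_average_apply (isWeight_weight le_rfl) hW.norm_le f
  have h3 := hasSum_ite_eq (0 : ℤ) (((15 / 16 * t : ℝ) : ℂ) • f)
  rw [hf, smul_zero] at h1
  have h4 := h1.add h3
  rw [zero_add] at h4
  refine h2.unique (h4.congr_fun fun n => ?_)
  have ht' : (16 / 15 - t) ≠ 0 := by linarith
  rw [smul_smul, ← Complex.ofReal_mul]
  have hc : ∀ b : ℝ, (16 / 15 - t) * (15 / 16) * (b / (16 / 15 - t)) = 15 / 16 * b := fun b => by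
    rw [← mul_div_assoc, div_eq_iff ht']
    ring
  have hw : weight 0 n = (16 / 15 - t) * (15 / 16) * weight t n +
      if n = 0 then 15 / 16 * t else 0 := by
    unfold weight
    rw [hc]
    split_ifs <;> ring
  rw [hw, Complex.ofReal_add, add_smul]
  congr 1
  split_ifs with hn
  · rw [hn, hW.map_zero]
    rfl
  · simp

theorem countable_not_injective_average_weight [TopologicalSpace.SeparableSpace H]
    {W : ℤ → H →L[ℂ] H} (hW : IsUnitaryRep W) :
    {t : ℝ | t ≤ 0 ∧ ¬Function.Injective (average (weight t) W)}.Countable := by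
  have hex : ∀ t : ℝ, t ≤ 0 ∧ ¬Function.Injective (average (weight t) W) →
      ∃ f : H, ‖f‖ = 1 ∧ average (weight t) W f = 0 := by
    rintro t ⟨-, ht⟩
    rw [injective_iff_map_eq_zero] at ht
    push Not at ht
    obtain ⟨f, hf, hne⟩ := ht
    refine ⟨((‖f‖⁻¹ : ℝ) : ℂ) • f, ?_, by rw [map_smul, hf, smul_zero]⟩
    rw [norm_smul, Complex.norm_real, norm_inv, norm_norm, inv_mul_cancel₀ (norm_ne_zero_iff.2 hne)]
  choose! f hf1 hf0 using hex
  have hsymm : ∀ u v : H, inner ℂ (average (weight 0) W u) v =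
      inner ℂ u (average (weight 0) W v) := by
    intro u v
    rw [← ContinuousLinearMap.adjoint_inner_right, hW.adjoint_average (isWeight_weight le_rfl)]
    have h := hasSum_inner_average (isWeight_weight le_rfl) (V := fun n => W (-n))
      (fun n => hW.norm_le _) v u
    have h' := (Equiv.neg ℤ).hasSum_iff.2 (hasSum_inner_average (isWeight_weight le_rfl)
      hW.norm_le v u)
    refine h.unique (h'.congr_fun fun n => ?_)
    simp [weight_neg]
  refine Set.PairwiseDisjoint.countable_of_isOpen (s := fun t => Metric.ball (f t) (1 / 2)) ?_
    (fun t _ => Metric.isOpen_ball) (fun t _ => ⟨f t, Metric.mem_ball_self (by norm_num)⟩)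
  intro s hs t ht hst
  have horth : inner ℂ (f s) (f t) = 0 := by
    have h := hsymm (f s) (f t)
    rw [average_weight_zero_apply hW hs.1 (hf0 s hs), average_weight_zero_apply hW ht.1 (hf0 t ht),
      inner_smul_left, inner_smul_right, Complex.conj_ofReal, ← sub_eq_zero, ← sub_mul,
      ← Complex.ofReal_sub, mul_eq_zero, Complex.ofReal_eq_zero] at h
    refine h.resolve_left fun h => hst ?_
    linarith
  refine Metric.ball_disjoint_ball ?_
  rw [dist_eq_norm]
  have h := norm_sub_sq (𝕜 := ℂ) (f s) (f t)
  rw [horth, hf1 s hs, hf1 t ht] at h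
  norm_num at h
  nlinarith [norm_nonneg (f s - f t)]

end Spectrum

section Symbol

open AddCircle

/-- The function with Fourier coefficients `a`. -/
def symbol (a : ℤ → ℝ) (z : UnitAddCircle) : ℂ := ∑' n : ℤ, (a n : ℂ) * fourier n z

variable {a : ℤ → ℝ} (ha : IsWeight a)
include ha

theorem norm_weight_mul_fourier_le (n : ℤ) (z : UnitAddCircle) :
    ‖(a n : ℂ) * fourier n z‖ ≤ a n := by
  rw [norm_mul, Complex.norm_real, Real.norm_of_nonneg (ha.nonneg n), fourier_apply,
    Circle.norm_coe, mul_one]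

theorem continuous_symbol : Continuous (symbol a) :=
  continuous_tsum (fun n => by fun_prop) ha.hasSum.summable (norm_weight_mul_fourier_le ha)

theorem norm_symbol_le (z : UnitAddCircle) : ‖symbol a z‖ ≤ 1 :=
  tsum_of_norm_bounded ha.hasSum fun n => norm_weight_mul_fourier_le ha n z

theorem memLp_symbol_mul (F : Lp ℂ 2 (haarAddCircle (T := 1))) :
    MemLp (fun z => symbol a z * F z) 2 haarAddCircle := by
  refine (Lp.memLp F).of_le ((continuous_symbol ha).aestronglyMeasurable.mul
    (Lp.aestronglyMeasurable F)) (Eventually.of_forall fun z => ?_)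
  rw [norm_mul]
  exact mul_le_of_le_one_left (norm_nonneg _) (norm_symbol_le ha z)

theorem fourierCoeff_symbol_mul (F : Lp ℂ 2 (haarAddCircle (T := 1))) (m : ℤ) :
    fourierCoeff (fun z => symbol a z * F z) m = conv a (fourierCoeff F) m := by
  have hF : Integrable F (haarAddCircle (T := 1)) := (Lp.memLp F).integrable (by norm_num)
  have hint : ∀ n : ℤ, Integrable (fun z => (a n : ℂ) * (fourier (-(m - n)) z * F z))
      (haarAddCircle (T := 1)) := fun n => (hF.fourier_smul _).const_mul _
  have h := hasSum_integral_of_summable_integral_norm hint (by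
    simp only [norm_mul, Complex.norm_real, Real.norm_of_nonneg (ha.nonneg _), fourier_apply,
      Circle.norm_coe, one_mul, integral_const_mul]
    exact ha.hasSum.summable.mul_right _)
  simp only [integral_const_mul] at h
  rw [conv]
  refine Eq.trans ?_ h.tsum_eq.symm
  refine integral_congr_ae (Eventually.of_forall fun z => ?_)
  simp only [symbol, smul_eq_mul]
  rw [mul_left_comm, ← tsum_mul_right]
  congr 1
  ext n
  rw [show -(m - n) = -m + n by ring, fourier_add]
  ring

theorem exists_trigPolynomial {x : ℤ → ℂ} (hx : Memℓp x 2)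
    (hfin : (Function.support (conv a x)).Finite) :
    ∃ F : Lp ℂ 2 (haarAddCircle (T := 1)), fourierCoeff F = x ∧
      ∀ᵐ z ∂haarAddCircle, symbol a z * F z =
        ∑ n ∈ hfin.toFinset, conv a x n * fourier n z := by
  set F : Lp ℂ 2 (haarAddCircle (T := 1)) := fourierBasis.repr.symm ⟨x, hx⟩ with hFdef
  have hF : fourierCoeff F = x := by
    ext n
    rw [← fourierBasis_repr, hFdef, LinearIsometryEquiv.apply_symm_apply]
  refine ⟨F, hF, ?_⟩
  set P : C(UnitAddCircle, ℂ) := ∑ n ∈ hfin.toFinset, conv a x n • fourier n with hP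
  have hPz : ∀ z, P z = ∑ n ∈ hfin.toFinset, conv a x n * fourier n z := fun z => by
    simp [hP]
  have hPc : ∀ m, fourierCoeff P m = conv a x m := by
    intro m
    have hPf : (P : UnitAddCircle → ℂ) =
        ∑ n ∈ hfin.toFinset, conv a x n • (fourier n : UnitAddCircle → ℂ) := by
      ext z
      simp [hP]
    rw [hPf, fourierCoeff.sum _ _ fun n _ =>
      ((map_continuous (fourier n)).integrable_of_hasCompactSupport
        (HasCompactSupport.of_compactSpace _)).smul _, Finset.sum_apply]
    simp only [fourierCoeff.const_smul, fourierCoeff_fourier, smul_eq_mul]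
    rw [Finset.sum_eq_single m]
    · simp
    · intro n _ hn
      rw [Pi.single_eq_of_ne hn.symm, mul_zero]
    · intro hm
      simpa using hm
  have heq : (memLp_symbol_mul ha F).toLp = ContinuousMap.toLp (E := ℂ) 2 haarAddCircle ℂ P := by
    refine fourierBasis.repr.injective (lp.ext (funext fun m => ?_))
    rw [fourierBasis_repr, fourierBasis_repr, fourierCoeff_toLp, hPc,
      fourierCoeff_congr_ae (memLp_symbol_mul ha F).coeFn_toLp, fourierCoeff_symbol_mul ha, hF]
  filter_upwards [(memLp_symbol_mul ha F).coeFn_toLp,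
    ContinuousMap.coeFn_toLp (p := 2) (𝕜 := ℂ) haarAddCircle P] with z h1 h2
  rw [← hPz, ← h2, ← heq, h1]

end Symbol

section Blowup

open Topology

theorem eq_zero_of_abs_le_sqrt {c C : ℝ} (hc : c ∈ Set.Icc (0 : ℝ) 1) {P Y : ℝ → ℂ}
    {w : ℝ → ℝ} (hP : ContinuousAt P c) (hw : ∀ x, |w x| ≤ C * √|x - c|)
    (hY : IntegrableOn (fun x => ‖Y x‖ ^ 2) (Set.Ioc 0 1))
    (h : ∀ᵐ x ∂volume.restrict (Set.Ioc (0 : ℝ) 1), (w x : ℂ) * Y x = P x) : P c = 0 := by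
  classical
  by_contra hPc
  set f : ℝ → ℝ := fun x => if (w x : ℂ) * Y x = P x then ‖Y x‖ ^ 2 else |x - c|⁻¹ with hf
  have hfi : IntervalIntegrable f volume 0 1 := by
    rw [intervalIntegrable_iff_integrableOn_Ioc_of_le zero_le_one]
    refine hY.congr ?_
    filter_upwards [h] with x hx
    rw [hf]
    simp only [hx, if_true]
  set η : ℝ := ‖P c‖ / 2 with hη
  have hη0 : 0 < η := half_pos (norm_pos_iff.2 hPc)
  refine not_intervalIntegrable_of_sub_inv_isBigO_punctured (f := f) (c := c)
    (Asymptotics.IsBigO.of_bound (C ^ 2 / η ^ 2 + 1) ?_) zero_ne_one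
    (by rwa [Set.uIcc_of_le zero_le_one]) hfi
  have hnear : ∀ᶠ x in 𝓝[≠] c, η < ‖P x‖ :=
    nhdsWithin_le_nhds (hP.norm.eventually_const_lt (half_lt_self (norm_pos_iff.2 hPc)))
  filter_upwards [hnear, self_mem_nhdsWithin] with x hx hxc
  have hd : 0 < |x - c| := abs_pos.2 (sub_ne_zero.2 hxc)
  rw [norm_inv, Real.norm_eq_abs, hf]
  by_cases hgood : (w x : ℂ) * Y x = P x
  · simp only [hgood, if_true, norm_pow, norm_norm]
    rw [← hgood, norm_mul, Complex.norm_real, Real.norm_eq_abs] at hx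
    have h1 : η ≤ C * √|x - c| * ‖Y x‖ :=
      hx.le.trans (mul_le_mul_of_nonneg_right (hw x) (norm_nonneg _))
    have h2 : η ^ 2 ≤ C ^ 2 * |x - c| * ‖Y x‖ ^ 2 := by
      have := pow_le_pow_left₀ hη0.le h1 2
      rwa [mul_pow, mul_pow, Real.sq_sqrt hd.le] at this
    have h3 : |x - c|⁻¹ ≤ C ^ 2 / η ^ 2 * ‖Y x‖ ^ 2 := by
      rw [inv_le_iff_one_le_mul₀ hd, div_mul_eq_mul_div, div_mul_eq_mul_div,
        one_le_div (by positivity)]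
      linarith
    nlinarith [sq_nonneg ‖Y x‖]
  · simp only [hgood, if_false, norm_inv, Real.norm_eq_abs, abs_abs]
    exact le_mul_of_one_le_left (by positivity) (le_add_of_nonneg_left (by positivity))

end Blowup

section Admissible

open Topology AddCircle

theorem isAdmissible_weight {t : ℝ} (ht : t ∈ Set.Ioo (-14 / 15 : ℝ) 0)
    (hnull : volume {x : ℝ | lacunary x = t} = 0)
    (hacc : ∀ x, lacunary x = t → ∃ᶠ y in 𝓝[≠] x, lacunary y = t) :
    IsAdmissible (weight t) := by
  have ha := isWeight_weight ht.2.le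
  refine ⟨ha.nonneg, ?_, ha.hasSum, fun x hx hfin => ?_⟩
  · refine Memℓp.of_exponent_ge (q := 1) ((memℓp_gen_iff (by norm_num)).2 ?_) (by norm_num)
    simpa [abs_of_nonneg (ha.nonneg _)] using ha.hasSum.summable
  obtain ⟨F, hF, hFP⟩ := exists_trigPolynomial ha hx hfin
  have hmk : MeasurePreserving ((↑) : ℝ → UnitAddCircle) (volume.restrict (Set.Ioc 0 1))
      haarAddCircle := by
    have h := UnitAddCircle.measurePreserving_mk 0
    rw [zero_add, volume_eq_smul_haarAddCircle, ENNReal.ofReal_one, one_smul] at h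
    exact h
  set w : ℝ → ℝ := fun x => (lacunary x - t) / (16 / 15 - t) with hwdef
  have hsymb : ∀ x : ℝ, symbol (weight t) x = w x := fun x => (hasSum_weight_fourier t x).tsum_eq
  set P : ℝ → ℂ := fun x => ∑ n ∈ hfin.toFinset, conv (weight t) _ n * fourier n (x : UnitAddCircle)
    with hPdef
  have hae : ∀ᵐ x ∂volume.restrict (Set.Ioc (0 : ℝ) 1), (w x : ℂ) * F (x : UnitAddCircle) = P x := by
    filter_upwards [hmk.quasiMeasurePreserving.ae hFP] with x hx
    rw [← hsymb, hx]
  have hPan : AnalyticOnNhd ℝ P Set.univ := by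
    intro y _
    simp only [hPdef, fourier_coe_apply]
    have h : AnalyticAt ℝ (fun x : ℝ => (x : ℂ)) y := Complex.ofRealCLM.analyticAt y
    refine Finset.analyticAt_fun_sum _ fun n _ => analyticAt_const.mul ?_
    have hexp : AnalyticAt ℂ
        (fun z : ℂ => Complex.exp (2 * Real.pi * Complex.I * n * z / (1 : ℝ))) (y : ℂ) := by
      fun_prop
    exact hexp.restrictScalars.comp h
  have hPcont : Continuous P := by
    rw [continuous_iff_continuousAt]
    exact fun y => (hPan y trivial).continuousAt
  have hY : IntegrableOn (fun x : ℝ => ‖F (x : UnitAddCircle)‖ ^ 2) (Set.Ioc 0 1) :=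
    (hmk.integrable_comp_of_integrable
      ((memLp_two_iff_integrable_sq_norm (Lp.aestronglyMeasurable F)).1 (Lp.memLp F)))
  obtain ⟨C, hC, hHolder⟩ := exists_abs_lacunary_sub_le
  have hzero : ∀ c ∈ Set.Icc (0 : ℝ) 1, lacunary c = t → P c = 0 := by
    intro c hc hct
    refine eq_zero_of_abs_le_sqrt (C := C) hc hPcont.continuousAt (fun x => ?_) hY hae
    rw [hwdef, abs_div]
    refine (div_le_self (abs_nonneg _) ?_).trans (hct ▸ hHolder x c)
    rw [abs_of_pos] <;> linarith [ht.2]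
  obtain ⟨c, hc, hct⟩ := exists_lacunary_eq ht
  have hfreq : ∃ᶠ y in 𝓝[≠] c, P y = 0 := by
    refine ((hacc c hct).and_eventually
      (nhdsWithin_le_nhds (isOpen_Ioo.mem_nhds hc))).mono fun y hy => ?_
    exact hzero y (Set.Ioo_subset_Icc_self hy.2) hy.1
  have hP0 : ∀ y, P y = 0 := fun y =>
    hPan.eqOn_zero_of_preconnected_of_frequently_eq_zero isPreconnected_univ trivial hfreq
      (Set.mem_univ y)
  have hF0 : ∀ᵐ x : ℝ ∂volume.restrict (Set.Ioc (0 : ℝ) 1), F (x : UnitAddCircle) = 0 := by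
    have hne : ∀ᵐ x : ℝ, lacunary x ≠ t := by
      rw [ae_iff]
      simpa using hnull
    filter_upwards [hae, ae_restrict_of_ae hne] with x h1 h2
    rw [hP0, mul_eq_zero] at h1
    refine h1.resolve_left fun h => ?_
    rw [Complex.ofReal_eq_zero, hwdef, div_eq_zero_iff] at h
    rcases h with h | h
    · exact h2 (sub_eq_zero.1 h)
    · linarith [ht.2]
  ext n
  rw [← hF, fourierCoeff_eq_intervalIntegral _ n 0, zero_add,
    intervalIntegral.integral_of_le zero_le_one, integral_congr_ae (g := fun _ => 0)]
  · simp
  · filter_upwards [hF0] with x hx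
    rw [hx, smul_zero]

end Admissible

theorem exists_isAdmissible_injective_average {H : Type*} [NormedAddCommGroup H]
    [InnerProductSpace ℂ H] [CompleteSpace H] [TopologicalSpace.SeparableSpace H]
    {W : ℤ → H →L[ℂ] H} (hW : IsUnitaryRep W) :
    ∃ a, IsAdmissible a ∧ Function.Injective (average a W) := by
  have hC := (countable_not_injective_average_weight hW).union
    (Measure.countable_meas_level_set_pos (μ := volume) continuous_lacunary.measurable)
  obtain ⟨t, ht, htC, hacc⟩ := exists_level hC
  simp only [Set.mem_union, Set.mem_ofPred_eq, not_or, not_and, not_not, not_lt,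
    nonpos_iff_eq_zero] at htC
  exact ⟨weight t, isAdmissible_weight ht htC.2 hacc, htC.1 ht.2.le⟩

theorem IsMarkov.markovQuasiAffine {Ω₁ Ω₂ : Type*} [MeasurableSpace Ω₁] [MeasurableSpace Ω₂]
    {μ₁ : Measure Ω₁} {μ₂ : Measure Ω₂} [IsProbabilityMeasure μ₁] [IsProbabilityMeasure μ₂]
    {V : Lp ℂ 2 μ₁ →L[ℂ] Lp ℂ 2 μ₂} {A₁ : Lp ℂ 2 μ₁ →L[ℂ] Lp ℂ 2 μ₁}
    {A₂ : Lp ℂ 2 μ₂ →L[ℂ] Lp ℂ 2 μ₂} (hV : IsMarkov V) (hinj : Function.Injective V)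
    (hd : DenseRange V) (h : V ∘L A₁ = A₂ ∘L V) : MarkovQuasiAffine A₁ A₂ :=
  ⟨V, hV, hinj, hd, h⟩

theorem MarkovQuasiAffine.isMarkovQuasiImage {Ω₁ Ω₂ : Type*} [MeasurableSpace Ω₁]
    [MeasurableSpace Ω₂] {μ₁ : Measure Ω₁} {μ₂ : Measure Ω₂} [IsProbabilityMeasure μ₁]
    [IsProbabilityMeasure μ₂] {A₁ : Lp ℂ 2 μ₁ →L[ℂ] Lp ℂ 2 μ₁} {A₂ : Lp ℂ 2 μ₂ →L[ℂ] Lp ℂ 2 μ₂}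
    (h : MarkovQuasiAffine A₁ A₂) : IsMarkovQuasiImage A₂ A₁ := by
  obtain ⟨V, hV, -, hd, h⟩ := h
  exact ⟨V, hV, hd, h⟩

end MarkovQS

end

theorem mainTheorem2 {X : Type*} [MeasurableSpace X] [StandardBorelSpace X]
    (μ : Measure X) [IsProbabilityMeasure μ]
    (T S : X ≃ᵐ X) (hT : Ergodic T μ) (hS : MeasurePreserving S μ μ)
    (hST : ∀ᵐ x ∂μ, S (T x) = T (S x))
    (φ : X → ZMod 2) (hφ : Measurable φ)
    (hTφ : Ergodic (MarkovQS.groupExtension T φ) (μ.prod MarkovQS.coin))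
    (hTψ : Ergodic (MarkovQS.T₁ T S φ) (μ.prod MarkovQS.cubeHaar)) :
    let U₁ := MarkovQS.koopman (MarkovQS.T₁ T S φ)
      (MarkovQS.T₁_measurePreserving hT.toMeasurePreserving hS hφ)
    let U₂ := MarkovQS.koopman (MarkovQS.T₂ T S φ)
      (MarkovQS.T₂_measurePreserving hT.toMeasurePreserving hS hφ)
    let J := fun a : ℤ → ℝ => MarkovQS.opJ a S hS
    let Jadj := fun a : ℤ → ℝ => ContinuousLinearMap.adjoint (MarkovQS.opJ a S hS)
    (∀ n : ℤ, MarkovQS.imap S n ∘ MarkovQS.T₁ T S φ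
        =ᵐ[μ.prod MarkovQS.cubeHaar] MarkovQS.T₂ T S φ ∘ MarkovQS.imap S n) ∧
    (∀ a : ℤ → ℝ, MarkovQS.IsAdmissible a →
      MarkovQS.IsMarkov (J a) ∧ U₁ ∘L J a = J a ∘L U₂ ∧ U₂ ∘L Jadj a = Jadj a ∘L U₁ ∧
      (Function.Injective (MarkovQS.opBase a S hS) →
        Function.Injective (J a) ∧ Function.Injective (Jadj a) ∧
        DenseRange (J a) ∧ DenseRange (Jadj a))) ∧
    (∃ a : ℤ → ℝ, MarkovQS.IsAdmissible a ∧
      Function.Injective (J a) ∧ Function.Injective (Jadj a) ∧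
      DenseRange (J a) ∧ DenseRange (Jadj a)) ∧
    MarkovQS.MarkovQuasiAffine U₁ U₂ ∧ MarkovQS.MarkovQuasiAffine U₂ U₁ ∧
    MarkovQS.MarkovQuasiSimilar U₁ U₂ := by
  intro U₁ U₂ J Jadj
  have hT' := hT.toMeasurePreserving
  have hmarkov : ∀ a, MarkovQS.IsAdmissible a → MarkovQS.IsMarkov (J a) := fun a ha =>
    MarkovQS.isMarkov_average ha.isWeight _
  have h₁ : ∀ a, MarkovQS.IsAdmissible a → U₁ ∘L J a = J a ∘L U₂ := fun a ha =>
    MarkovQS.koopman_T₁_comp_opJ hT' hS hST hφ ha.isWeight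
  have h₂ : ∀ a, MarkovQS.IsAdmissible a → U₂ ∘L Jadj a = Jadj a ∘L U₁ := fun a ha =>
    MarkovQS.koopman_T₂_comp_adjoint_opJ hT' hS hST hφ ha.isWeight
  have hinj : ∀ a, MarkovQS.IsAdmissible a → Function.Injective (MarkovQS.opBase a S hS) →
      Function.Injective (J a) ∧ Function.Injective (Jadj a) ∧
        DenseRange (J a) ∧ DenseRange (Jadj a) := by
    intro a ha hb
    have hJ := MarkovQS.injective_opJ hS ha hb
    have hJ' := MarkovQS.injective_adjoint_opJ hS ha hb
    refine ⟨hJ, hJ', MarkovQS.denseRange_of_injective_adjoint hJ',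
      MarkovQS.denseRange_of_injective_adjoint ?_⟩
    rwa [ContinuousLinearMap.adjoint_adjoint]
  have : Fact ((2 : ℝ≥0∞) ≠ ∞) := ⟨by norm_num⟩
  obtain ⟨a, ha, hb⟩ :=
    MarkovQS.exists_isAdmissible_injective_average (MarkovQS.isUnitaryRep_ipow hS)
  obtain ⟨hJ, hJ', hd, hd'⟩ := hinj a ha hb
  have hq₁ : MarkovQS.MarkovQuasiAffine U₁ U₂ :=
    (hmarkov a ha).adjoint.markovQuasiAffine hJ' hd' (h₂ a ha).symm
  have hq₂ : MarkovQS.MarkovQuasiAffine U₂ U₁ :=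
    (hmarkov a ha).markovQuasiAffine hJ hd (h₁ a ha).symm
  exact ⟨fun n => MarkovQS.imap_comp_T₁ hS hST φ n,
    fun a ha => ⟨hmarkov a ha, h₁ a ha, h₂ a ha, hinj a ha⟩, ⟨a, ha, hJ, hJ', hd, hd'⟩,
    hq₁, hq₂, hq₁.isMarkovQuasiImage, hq₂.isMarkovQuasiImage⟩
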